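/- **Setting.** Let $A\in\mathbb R^{m\times n}$ be a matrix whose rows are $m$ data points, and let $1\le k\le m$. A $k$-clustering is a partition of the points into $k$ non-empty clusters of sizes $s_1,\dots,s_k$. It is represented by its indicator matrix $X\in\mathbb R^{m\times k}$, where $X_{ij}=1/\sqrt{s_j}$ if point $i$ is in cluster $j$, and $X_{ij}=0$ otherwise. The cost of $X$ on $A$ is $\mathcal F(A,X)=\|A-XX^{\mathsf T}A\|_F^2$, and $\mathrm F_{\mathrm{opt}}(A)=\min_X\mathcal F(A,X)$ over all $m\times k$ indicator matrices $X$. A $\gamma$-approximation algorithm ($\gamma\ge1$) with failure probability $\delta_\gamma$ is a randomized algorithm that on every dataset $C$ returns an indicator matrix $X$ such that $\mathcal F(C,X)\le\gamma\,\mathrm F_{\mathrm{opt}}(C)$ with probability at least $1-\delta_\gamma$. For $c\in\mathbb N$ and $\epsilon\in(0,1/3)$ put $r=\lceil c\,k/\epsilon^2\rceil$. Let $R$ be the random $n\times r$ matrix whose entries are independent and equal to $+1/\sqrt r$ or $-1/\sqrt r$ with probability $1/2$ each. **Theorem (random projection feature extraction).** There is a constant $c_0\in\mathbb N$ such that for every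 natural number $c\ge c_0$ the following two statements hold. 1. (Running time.) There are a randomized program $P$ and a constant $K$, both depending only on $c$, such that for all $m$, $n\ge2$, $1\le k\le m$, $\epsilon\in(0,1/3)$ and $A\in\mathbb R^{m\times n}$, the program $P$ on input $(A,k,\epsilon)$ always halts within $K\,m\,n\,\lceil \epsilon^{-2}k/\log n\rceil$ steps and outputs $r=\lceil ck/\epsilon^2\rceil$ and a random matrix $C\in\mathbb R^{m\times r}$ that has the law of $AR$. Programs run on a random access machine with exact real arithmetic (including square roots) and with integer words that never exceed the same bound $K\,m\,n\,\lceil \epsilon^{-2}k/\log n\rceil$. Each operation costs one step, including drawing a uniformly random word below a given bound. 2. (Quality.) For all $m,n$, $1\le k\le m$, $\epsilon\in(0,1/3)$, $A\in\mathbb R^{m\times n}$, every $\gamma\ge1$ and every $\gamma$-approximation $k$-means algorithm with failure probability $\delta_\gamma$, let $X_{\tilde\gamma}$ be the indicator matrix that the algorithm returns, with randomness independent of $R$, on the data $C=AR$ and $k$. Then with probability at least $0.96-\delta_\gamma$ (over $R$ and the randomness of the algorithm), $$\|A-X_{\tilde\gamma}X_{\tilde\gamma}^{\mathsf T}A\|_F^2\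 \le\ \bigl(1+(1+\epsilon)\gamma\bigr)\,\mathrm F_{\mathrm{opt}}(A).$$ -/

import Mathlib

noncomputable section

open scoped Classical

/-! ### The k-means problem in matrix form -/

namespace KMeans

/-- The squared Frobenius norm of a real matrix. -/
def frobSq {m n : ℕ} (M : Matrix (Fin m) (Fin n) ℝ) : ℝ :=
  ∑ i, ∑ j, M i j ^ 2

/-- `X` is the cluster indicator matrix of a partition of `m` points into `k` non-empty clusters:
point `i` lies in cluster `f i`, and `X i j = 1 / √s_j` if `f i = j` (where `s_j` is the size of
cluster `j`), and `X i j = 0` otherwise. -/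
def IsIndicator {m k : ℕ} (X : Matrix (Fin m) (Fin k) ℝ) : Prop :=
  ∃ f : Fin m → Fin k, Function.Surjective f ∧
    ∀ i j, X i j =
      if f i = j then 1 / Real.sqrt ((Finset.univ.filter (fun p => f p = j)).card : ℝ) else 0

/-- The k-means objective `‖A - X Xᵀ A‖_F²` of the clustering `X` on the rows of `A`. -/
def cost {m n k : ℕ} (A : Matrix (Fin m) (Fin n) ℝ) (X : Matrix (Fin m) (Fin k) ℝ) : ℝ :=
  frobSq (A - X * X.transpose * A)

/-- The optimal value of the k-means objective on `A` with `k` clusters. For `1 ≤ k ≤ m` the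
infimum is a minimum, see `optCost_isLeast`. -/
def optCost {m n : ℕ} (A : Matrix (Fin m) (Fin n) ℝ) (k : ℕ) : ℝ :=
  sInf {c : ℝ | ∃ X : Matrix (Fin m) (Fin k) ℝ, IsIndicator X ∧ c = cost A X}

theorem optCost_isLeast {m n k : ℕ} (hk : 1 ≤ k) (hkm : k ≤ m) (A : Matrix (Fin m) (Fin n) ℝ) :
    IsLeast {c : ℝ | ∃ X : Matrix (Fin m) (Fin k) ℝ, IsIndicator X ∧ c = cost A X}
      (optCost A k) := by
  have hfin : {c : ℝ | ∃ X : Matrix (Fin m) (Fin k) ℝ, IsIndicator X ∧ c = cost A X}.Finite := by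
    refine (Set.finite_range (fun f : Fin m → Fin k => cost A (Matrix.of fun i j =>
      if f i = j then 1 / Real.sqrt ((Finset.univ.filter (fun p => f p = j)).card : ℝ)
      else 0))).subset ?_
    rintro c ⟨X, ⟨f, -, hX⟩, rfl⟩
    refine ⟨f, ?_⟩
    have hXe : X = Matrix.of fun i j =>
        if f i = j then 1 / Real.sqrt ((Finset.univ.filter (fun p => f p = j)).card : ℝ)
        else 0 := by
      ext i j
      exact hX i j
    simp only [hXe]
  have hne : {c : ℝ | ∃ X : Matrix (Fin m) (Fin k) ℝ, IsIndicator X ∧ c = cost A X}.Nonempty := by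
    refine ⟨_, Matrix.of fun i j =>
      if (fun p : Fin m => if h : p.1 < k then (⟨p.1, h⟩ : Fin k) else ⟨0, hk⟩) i = j then
        1 / Real.sqrt ((Finset.univ.filter (fun q =>
          (fun p : Fin m => if h : p.1 < k then (⟨p.1, h⟩ : Fin k) else ⟨0, hk⟩) q = j)).card : ℝ)
      else 0, ⟨_, ?_, fun i j => rfl⟩, rfl⟩
    intro j
    exact ⟨⟨j.1, lt_of_lt_of_le j.2 hkm⟩, by simp⟩
  exact ⟨hne.csInf_mem hfin, fun c hc => csInf_le hfin.bddBelow hc⟩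

/-- A randomized algorithm for clustering `m` points of `ℝ^r` into `k` clusters maps every dataset
to the law of its output. (There are only finitely many indicator matrices, so this law is
discrete.) It is a `γ`-approximation with failure probability `δ` if on every dataset it always
returns an indicator matrix, whose cost is at most `γ` times the optimum with probability at least
`1 - δ`. -/
def IsApproximation {m r k : ℕ} (γ δ : ℝ)
    (alg : Matrix (Fin m) (Fin r) ℝ → PMF (Matrix (Fin m) (Fin k) ℝ)) : Prop :=
  1 ≤ γ ∧ ∀ C : Matrix (Fin m) (Fin r) ℝ,
    (∀ X ∈ (alg C).support, IsIndicator X) ∧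
    ENNReal.ofReal (1 - δ) ≤ (alg C).toOuterMeasure {X | cost C X ≤ γ * optCost C k}

/-- The law of the rescaled random sign matrix: the entries of an `n × r` matrix are independent
and each is `1/√r` or `-1/√r` with probability `1/2`. -/
def signMatrix (n r : ℕ) : PMF (Matrix (Fin n) (Fin r) ℝ) :=
  (PMF.uniformOfFintype (Fin n → Fin r → Bool)).map
    (fun S => Matrix.of fun i j => if S i j then 1 / Real.sqrt r else -(1 / Real.sqrt r))

/-- The law of the random features `C = A R`, where `R` is the rescaled random sign matrix. -/
def features {m n : ℕ} (A : Matrix (Fin m) (Fin n) ℝ) (r : ℕ) : PMF (Matrix (Fin m) (Fin r) ℝ) :=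
  (signMatrix n r).map (fun R => A * R)

end KMeans

/-! ### A randomized real random access machine

The machine has integer (natural number) registers and arrays, and real registers and arrays. Real
numbers are stored exactly. Integers are machine words: a computation that produces an integer
larger than the word bound `W` crashes. Every instruction, and every control step, costs one unit of
time. One instruction draws a uniformly random word below a given bound. There is no rounding
instruction, and the constants in a program are natural numbers. -/

namespace RealRAM

inductive IntOp
  | add
  | sub
  | mul
  | div

/-- Subtraction is truncated at `0` and division rounds down (division by `0` gives `0`). -/
def IntOp.eval : IntOp → ℕ → ℕ → ℕ
  | .add, a, b => a + b
  | .sub, a, b => a - b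
  | .mul, a, b => a * b
  | .div, a, b => a / b

inductive RealOp
  | add
  | sub
  | mul
  | div

def RealOp.eval : RealOp → ℝ → ℝ → ℝ
  | .add, a, b => a + b
  | .sub, a, b => a - b
  | .mul, a, b => a * b
  | .div, a, b => a / b

/-- Instructions. Registers and arrays are named by natural numbers; `x y z` stand for integer
registers, `u v w` for real registers, and `a` for an array, whose address is held in the integer
register `y`. -/
inductive Instr
  | intConst (x c : ℕ)
  | intOp (o : IntOp) (x y z : ℕ)
  | intLoad (x a y : ℕ)
  | intStore (a y x : ℕ)
  | rand (x y : ℕ)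
  | ofInt (u x : ℕ)
  | realOp (o : RealOp) (u v w : ℕ)
  | sqrt (u v : ℕ)
  | realLoad (u a y : ℕ)
  | realStore (a y u : ℕ)

/-- Tests: compare two integer registers or two real registers. -/
inductive Test
  | intLt (x y : ℕ)
  | realLt (u v : ℕ)

/-- Structured programs. -/
inductive Program
  | instr (i : Instr)
  | seq (p q : Program)
  | ite (t : Test) (p q : Program)
  | while (t : Test) (p : Program)

structure Store where
  ireg : ℕ → ℕ
  imem : ℕ → ℕ → ℕ
  rreg : ℕ → ℝ
  rmem : ℕ → ℕ → ℝ

/-- Write `c` into integer register `x`; crash (`none`) if `c` exceeds the word bound. -/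
def Store.setInt (W : ℕ) (s : Store) (x c : ℕ) : Option Store :=
  if c ≤ W then some { s with ireg := Function.update s.ireg x c } else none

/-- Write `c` into real register `u`. -/
def Store.setReal (s : Store) (u : ℕ) (c : ℝ) : Store :=
  { s with rreg := Function.update s.rreg u c }

/-- The effect of one instruction. -/
def Instr.exec (W : ℕ) : Instr → Store → PMF (Option Store)
  | .intConst x c, s => PMF.pure (s.setInt W x c)
  | .intOp o x y z, s => PMF.pure (s.setInt W x (o.eval (s.ireg y) (s.ireg z)))
  | .intLoad x a y, s => PMF.pure (s.setInt W x (s.imem a (s.ireg y)))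
  | .intStore a y x, s => PMF.pure (some { s with
      imem := Function.update s.imem a (Function.update (s.imem a) (s.ireg y) (s.ireg x)) })
  | .rand x y, s =>
      if h : 0 < s.ireg y then
        (PMF.uniformOfFinset (Finset.range (s.ireg y)) ⟨0, Finset.mem_range.mpr h⟩).map
          (fun c => s.setInt W x c)
      else PMF.pure none
  | .ofInt u x, s => PMF.pure (some (s.setReal u (s.ireg x : ℝ)))
  | .realOp o u v w, s => PMF.pure (some (s.setReal u (o.eval (s.rreg v) (s.rreg w))))
  | .sqrt u v, s => PMF.pure (some (s.setReal u (Real.sqrt (s.rreg v))))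
  | .realLoad u a y, s => PMF.pure (some (s.setReal u (s.rmem a (s.ireg y))))
  | .realStore a y u, s => PMF.pure (some { s with
      rmem := Function.update s.rmem a (Function.update (s.rmem a) (s.ireg y) (s.rreg u)) })

def Test.holds : Test → Store → Prop
  | .intLt x y, s => s.ireg x < s.ireg y
  | .realLt u v, s => s.rreg u < s.rreg v

/-- A configuration: the programs that remain to be executed, in order, and the store. The machine
has halted when no program remains. -/
abbrev Config := List Program × Store

/-- One step of the machine; `none` is the crashed machine. -/
def step (W : ℕ) : Option Config → PMF (Option Config)
  | none => PMF.pure none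
  | some ([], s) => PMF.pure (some ([], s))
  | some (.instr i :: K, s) => (i.exec W s).map (Option.map fun s' => (K, s'))
  | some (.seq p q :: K, s) => PMF.pure (some (p :: q :: K, s))
  | some (.ite t p q :: K, s) => PMF.pure (some (if t.holds s then p :: K else q :: K, s))
  | some (.while t p :: K, s) =>
      PMF.pure (some (if t.holds s then p :: .while t p :: K else K, s))

/-- The law of the configuration after `T` steps. -/
def run (W : ℕ) : ℕ → Option Config → PMF (Option Config)
  | 0, c => PMF.pure c
  | T + 1, c => (step W c).bind (run W T)

/-- The initial store on input `(A, k, ε)`: the integer registers `0, 1, 2` hold `m, n, k`, the real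
register `0` holds `ε`, and the real array `0` holds `A` row by row; all else is zero. -/
def inputStore {m n : ℕ} (A : Matrix (Fin m) (Fin n) ℝ) (k : ℕ) (ε : ℝ) : Store where
  ireg := fun x => match x with
    | 0 => m
    | 1 => n
    | 2 => k
    | _ => 0
  imem := fun _ _ => 0
  rreg := fun u => match u with
    | 0 => ε
    | _ => 0
  rmem := fun a p => match a with
    | 0 => if h : p < m * n then A (Fin.divNat ⟨p, h⟩) (Fin.modNat ⟨p, h⟩) else 0
    | _ => 0

/-- The output of a machine that has halted without crashing, with `r` in the integer register `3`:
the `m × r` matrix stored row by row in the real array `1`. -/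
def output (m r : ℕ) : Option Config → Option (Matrix (Fin m) (Fin r) ℝ)
  | some ([], s) =>
      if s.ireg 3 = r then some (Matrix.of fun i j => s.rmem 1 (i.1 * r + j.1)) else none
  | _ => none

/-- On input `(A, k, ε)`, and for all outcomes of its random draws, the program `P` halts after at
most `T` steps without producing an integer larger than `W`; it outputs `r` and a random `m × r`
matrix with law `μ`. -/
def Computes {m n : ℕ} (P : Program) (W T : ℕ) (A : Matrix (Fin m) (Fin n) ℝ) (k : ℕ) (ε : ℝ)
    (r : ℕ) (μ : PMF (Matrix (Fin m) (Fin r) ℝ)) : Prop :=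
  (run W T (some ([P], inputStore A k ε))).map (output m r) = μ.map some

end RealRAM

end

open scoped BigOperators

/-! ### Moments of Rademacher sums -/

namespace Rademacher

/-! Quality. Let X₀ be an optimal clustering with cost F, U the span of its centers (of dimension at
most k), Q the orthogonal projection onto U, and D = 1 - XXᵀ for the clustering X returned on AR. D
acts on the indices of the points and Q on their coordinates, so they commute. With the residuals W
= A - QA this gives ‖DA‖² = ‖DQA‖² + ‖DW‖². The second term is at most F, because D is a contraction
and ‖W‖² ≤ F; it accounts for the 1 in 1 + (1+ε)γ. The first term, α, is compared with the projected
cost ‖DAR‖², which is at most γ‖(1 - X₀X₀ᵀ)AR‖².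

Three events suffice: R almost preserves norms on U (`prob_not_isometry_le`, by exponential moments
and a net), R does not inflate ‖(1 - X₀X₀ᵀ)A‖² by much (`prob_not_sum_gram_le`, by second moments),
and the images of U and of W are almost orthogonal (`prob_not_sum_cross_le`, by second moments). In
the cross term between DQA and DW, the symmetric idempotent D can be moved off W. The events
therefore involve only A and X₀; they serve all X at once, and X may depend on R. They yield (1 -
ε/4)α ≤ (1 + ε/4)γF, hence α ≤ (1+ε)γF (`sum_norm_sq_le_of_gram`, `residual_cost_le`).

Running time. The mailman algorithm takes L = ⌊log₂ n⌋ columns of signs at a time, so that each row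
of such a block of R is one random word of L bits. For a row of A, its n entries are added into 2^L
≤ n buckets according to their words. The upper half of the buckets minus the lower half gives the
signed sum for the top bit; adding the halves forgets that bit, and the procedure repeats. The sizes
decrease geometrically, so a block costs O(n) per row of A, and the total is O(mnr / log n). -/

theorem expect_cons {β : Type*} [Fintype β] {n : ℕ} (f : (Fin (n + 1) → β) → ℝ) :
    𝔼 ω, f ω = 𝔼 b, 𝔼 ω : Fin n → β, f (Fin.cons b ω) := by
  rw [← Fintype.expect_equiv (Fin.consEquiv fun _ => β) (fun x => f (Fin.cons x.1 x.2)) f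
    (fun _ => rfl), ← Finset.univ_product_univ, Finset.expect_product]

theorem expect_bool (f : Bool → ℝ) : 𝔼 b, f b = (f true + f false) / 2 := by
  rw [Fintype.expect_eq_sum_div_card]
  simp

/-- The sign encoded by a bit. -/
def sgn (b : Bool) : ℝ := if b then 1 else -1

@[simp] theorem sgn_true : sgn true = 1 := rfl

@[simp] theorem sgn_false : sgn false = -1 := rfl

/-- The signed sum `∑ ± x_j`. -/
def radSum {n : ℕ} (s : Fin n → Bool) (x : Fin n → ℝ) : ℝ := ∑ j, x j * sgn (s j)

theorem radSum_cons {n : ℕ} (b : Bool) (s : Fin n → Bool) (x : Fin (n + 1) → ℝ) :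
    radSum (Fin.cons b s) x = x 0 * sgn b + radSum s (fun j => x j.succ) := by
  simp [radSum, Fin.sum_univ_succ]

theorem expect_signs_succ {n : ℕ} (f : (Fin (n + 1) → Bool) → ℝ) :
    𝔼 s, f s = 𝔼 s : Fin n → Bool, (f (Fin.cons true s) + f (Fin.cons false s)) / 2 := by
  rw [expect_cons, expect_bool, ← Finset.expect_add_distrib, Finset.expect_div]

theorem expect_radSum_mul {n : ℕ} (x y : Fin n → ℝ) :
    𝔼 s, radSum s x * radSum s y = ∑ j, x j * y j := by
  induction n with
  | zero => simp [radSum]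
  | succ n ih =>
    rw [expect_signs_succ, Fin.sum_univ_succ, ← ih (fun j => x j.succ) (fun j => y j.succ),
      ← Fintype.expect_const (ι := Fin n → Bool) (x 0 * y 0), ← Finset.expect_add_distrib]
    refine Finset.expect_congr rfl fun s _ => ?_
    simp only [radSum_cons, sgn_true, sgn_false]
    ring

theorem expect_radSum_sq {n : ℕ} (x : Fin n → ℝ) : 𝔼 s, radSum s x ^ 2 = ∑ j, x j ^ 2 := by
  simpa only [sq] using expect_radSum_mul x x

/-- Odd moments cancel when a sign is split off, so the fourth moment grows by 6x₀²v + x₀⁴, where v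
is the sum of the other squares; 3(v + x₀²)² grows by at least as much. -/
theorem expect_radSum_pow_four_le {n : ℕ} (x : Fin n → ℝ) :
    𝔼 s, radSum s x ^ 4 ≤ 3 * (∑ j, x j ^ 2) ^ 2 := by
  induction n with
  | zero => simp [radSum]
  | succ n ih =>
    have h2 := expect_radSum_sq (fun j => x (Fin.succ j))
    have h4 := ih (fun j => x (Fin.succ j))
    have : 𝔼 s, radSum s x ^ 4 = 𝔼 s : Fin n → Bool, radSum s (fun j => x j.succ) ^ 4
        + 6 * x 0 ^ 2 * ∑ j, x (Fin.succ j) ^ 2 + x 0 ^ 4 := by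
      rw [expect_signs_succ, ← h2, Finset.mul_expect,
        ← Fintype.expect_const (ι := Fin n → Bool) (x 0 ^ 4), ← Finset.expect_add_distrib,
        ← Finset.expect_add_distrib]
      refine Finset.expect_congr rfl fun s _ => ?_
      simp only [radSum_cons, sgn_true, sgn_false]
      ring
    rw [this, Fin.sum_univ_succ]
    nlinarith [sq_nonneg (x 0 ^ 2)]

/-- Averaging over one sign produces cosh(2t x₀ y) ≤ exp(2t²x₀²y²), where y is the remaining sum.
The quadratic term is absorbed by replacing t with t(1 + 2t x₀²), which is why the induction is over
all t. The bound 1/8 is preserved by this replacement and makes the errors fit into the factor 2. -/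
theorem expect_exp_mul_radSum_sq_le {n : ℕ} (x : Fin n → ℝ) (t : ℝ) (ht : 0 ≤ t)
    (hx : t * ∑ j, x j ^ 2 ≤ 1 / 8) :
    𝔼 s, Real.exp (t * radSum s x ^ 2) ≤
      Real.exp (t * ∑ j, x j ^ 2 + 2 * (t * ∑ j, x j ^ 2) ^ 2) := by
  induction n generalizing t with
  | zero => simp [radSum]
  | succ n ih =>
    rw [Fin.sum_univ_succ] at hx ⊢
    set v := ∑ j : Fin n, x (Fin.succ j) ^ 2 with hv
    set a := x 0 ^ 2 with ha
    have hv0 : 0 ≤ v := Finset.sum_nonneg fun j _ => sq_nonneg _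
    have ha0 : 0 ≤ a := sq_nonneg _
    set p := t * a with hp
    set q := t * v with hq
    have hp0 : 0 ≤ p := mul_nonneg ht ha0
    have hq0 : 0 ≤ q := mul_nonneg ht hv0
    have hpq : p + q ≤ 1 / 8 := by rw [hp, hq]; linarith
    have ht' : 0 ≤ t * (1 + 2 * p) := by positivity
    have hq' : t * (1 + 2 * p) * v = q * (1 + 2 * p) := by rw [hq]; ring
    have key := ih (fun j => x j.succ) (t * (1 + 2 * p)) ht' (by
      rw [hq']
      nlinarith)
    rw [hq'] at key
    calc 𝔼 s, Real.exp (t * radSum s x ^ 2)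
        ≤ 𝔼 s : Fin n → Bool, Real.exp p *
            Real.exp (t * (1 + 2 * p) * radSum s (fun j => x j.succ) ^ 2) := by
          rw [expect_signs_succ]
          refine Finset.expect_le_expect fun s _ => ?_
          simp only [radSum_cons, sgn_true, sgn_false]
          set y := radSum s (fun j => x j.succ)
          have e1 : t * (x 0 * 1 + y) ^ 2 = (p + t * y ^ 2) + 2 * t * x 0 * y := by
            rw [hp, ha]; ring
          have e2 : t * (x 0 * (-1) + y) ^ 2 = (p + t * y ^ 2) + -(2 * t * x 0 * y) := by
            rw [hp, ha]; ring
          rw [e1, e2, Real.exp_add (p + t * y ^ 2), Real.exp_add (p + t * y ^ 2),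
            ← mul_add, mul_div_assoc, ← Real.cosh_eq]
          refine (mul_le_mul_of_nonneg_left (Real.cosh_le_exp_half_sq _)
            (Real.exp_nonneg _)).trans (le_of_eq ?_)
          rw [← Real.exp_add, ← Real.exp_add]
          congr 1
          rw [hp, ha]
          ring
      _ = Real.exp p * 𝔼 s : Fin n → Bool,
            Real.exp (t * (1 + 2 * p) * radSum s (fun j => x j.succ) ^ 2) := by
          rw [Finset.mul_expect]
      _ ≤ Real.exp p * Real.exp (q * (1 + 2 * p) + 2 * (q * (1 + 2 * p)) ^ 2) :=
          mul_le_mul_of_nonneg_left key (Real.exp_nonneg _)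
      _ ≤ _ := by
          rw [← Real.exp_add, Real.exp_le_exp, mul_add]
          have h1 : 0 ≤ p * q := mul_nonneg hp0 hq0
          nlinarith [mul_nonneg h1 hq0, mul_nonneg h1 hp0, mul_nonneg (mul_nonneg h1 hp0) hq0,
            mul_nonneg h1 (sub_nonneg.2 hpq), sq_nonneg p,
            mul_nonneg (mul_nonneg h1 hq0) (sub_nonneg.2 hpq)]

/-- Since e^z ≥ 1 + z + z²/2, it is enough that (1 - z + z²/2)(1 + z + z²/2) = 1 + z⁴/4 ≥ 1. -/
theorem exp_neg_le {z : ℝ} (hz : 0 ≤ z) : Real.exp (-z) ≤ 1 - z + z ^ 2 / 2 := by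
  have h := Real.quadratic_le_exp_of_nonneg hz
  rw [Real.exp_neg, inv_le_comm₀ (Real.exp_pos _) (by nlinarith [sq_nonneg (z - 1)])]
  refine le_trans ?_ h
  rw [inv_le_iff_one_le_mul₀ (by nlinarith [sq_nonneg (z - 1)])]
  nlinarith [sq_nonneg (z ^ 2)]

/-- For the lower tail second and fourth moments suffice, and t need not be small. -/
theorem expect_exp_neg_mul_radSum_sq_le {n : ℕ} (x : Fin n → ℝ) (t : ℝ) (ht : 0 ≤ t) :
    𝔼 s, Real.exp (-(t * radSum s x ^ 2)) ≤
      Real.exp (-(t * ∑ j, x j ^ 2) + 2 * (t * ∑ j, x j ^ 2) ^ 2) := by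
  calc 𝔼 s, Real.exp (-(t * radSum s x ^ 2))
      ≤ 𝔼 s : Fin n → Bool, (1 - t * radSum s x ^ 2 + t ^ 2 / 2 * radSum s x ^ 4) :=
        Finset.expect_le_expect fun s _ =>
          (exp_neg_le (by positivity)).trans (le_of_eq (by ring))
    _ = 1 - t * ∑ j, x j ^ 2 + t ^ 2 / 2 * 𝔼 s, radSum s x ^ 4 := by
        rw [Finset.expect_add_distrib, Finset.expect_sub_distrib, ← Finset.mul_expect,
          ← Finset.mul_expect, expect_radSum_sq, Fintype.expect_const]
    _ ≤ (-(t * ∑ j, x j ^ 2) + 2 * (t * ∑ j, x j ^ 2) ^ 2) + 1 := by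
        nlinarith [mul_le_mul_of_nonneg_left (expect_radSum_pow_four_le x)
          (by positivity : 0 ≤ t ^ 2 / 2), sq_nonneg (t * ∑ j, x j ^ 2)]
    _ ≤ _ := Real.add_one_le_exp _

/-! ### Independent copies -/

theorem expect_sum_copies {β : Type*} [Fintype β] [Nonempty β] (r : ℕ) (z : β → ℝ)
    (hz : 𝔼 b, z b = 0) : 𝔼 ω : Fin r → β, ∑ l, z (ω l) = 0 := by
  induction r with
  | zero => simp
  | succ r ih =>
    rw [expect_cons]
    simp only [Fin.sum_univ_succ, Fin.cons_zero, Fin.cons_succ, Finset.expect_add_distrib,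
      Fintype.expect_const, ih, hz, add_zero]

theorem expect_sum_copies_sq {β : Type*} [Fintype β] [Nonempty β] (r : ℕ) (z : β → ℝ)
    (hz : 𝔼 b, z b = 0) :
    𝔼 ω : Fin r → β, (∑ l, z (ω l)) ^ 2 = r * 𝔼 b, z b ^ 2 := by
  induction r with
  | zero => simp
  | succ r ih =>
    rw [expect_cons]
    have : ∀ b, 𝔼 ω : Fin r → β, (∑ l, z ((Fin.cons b ω : Fin (r + 1) → β) l)) ^ 2
        = z b ^ 2 + r * 𝔼 b, z b ^ 2 := by
      intro b
      simp only [Fin.sum_univ_succ, Fin.cons_zero, Fin.cons_succ, add_sq,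
        Finset.expect_add_distrib, Fintype.expect_const, ih, ← Finset.mul_expect,
        expect_sum_copies r z hz, mul_zero, add_zero]
    simp only [this, Finset.expect_add_distrib, Fintype.expect_const]
    push_cast
    ring

end Rademacher

namespace Rademacher

/-! ### Probabilities on a finite uniform space -/

open scoped Classical in
/-- The probability of an event under the uniform distribution on a finite type. -/
noncomputable def prob {Ω : Type*} [Fintype Ω] (p : Ω → Prop) : ℝ := 𝔼 ω, if p ω then (1 : ℝ) else 0

section prob

variable {Ω : Type*} [Fintype Ω]

theorem prob_mono {p q : Ω → Prop} (h : ∀ ω, p ω → q ω) : prob p ≤ prob q := by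
  refine Finset.expect_le_expect fun ω _ => ?_
  by_cases hp : p ω
  · simp [hp, h ω hp]
  · by_cases hq : q ω <;> simp [hp, hq]

theorem prob_or_le (p q : Ω → Prop) : prob (fun ω => p ω ∨ q ω) ≤ prob p + prob q := by
  unfold prob
  rw [← Finset.expect_add_distrib]
  refine Finset.expect_le_expect fun ω _ => ?_
  by_cases hp : p ω <;> by_cases hq : q ω <;> simp [hp, hq]

theorem prob_exists_le {ι : Type*} (N : Finset ι) (p : ι → Ω → Prop) :
    prob (fun ω => ∃ i ∈ N, p i ω) ≤ ∑ i ∈ N, prob (p i) := by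
  unfold prob
  rw [← Finset.expect_sum_comm]
  refine Finset.expect_le_expect fun ω _ => ?_
  classical
  have h0 : ∀ i ∈ N, (0 : ℝ) ≤ if p i ω then 1 else 0 := fun i _ => by split_ifs <;> norm_num
  by_cases h : ∃ i ∈ N, p i ω
  · obtain ⟨i, hi, hp⟩ := h
    rw [if_pos ⟨i, hi, hp⟩]
    calc (1 : ℝ) = if p i ω then 1 else 0 := by rw [if_pos hp]
      _ ≤ ∑ i ∈ N, if p i ω then 1 else 0 := Finset.single_le_sum h0 hi
      _ ≤ _ := le_of_eq (Finset.sum_congr rfl fun i _ => by congr)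
  · rw [if_neg h]
    exact Finset.sum_nonneg fun i _ => by split_ifs <;> norm_num

theorem mul_prob_le_expect {p : Ω → Prop} {f : Ω → ℝ} {a : ℝ} (hf : ∀ ω, 0 ≤ f ω)
    (h : ∀ ω, p ω → a ≤ f ω) : a * prob p ≤ 𝔼 ω, f ω := by
  unfold prob
  rw [Finset.mul_expect]
  refine Finset.expect_le_expect fun ω _ => ?_
  by_cases hp : p ω <;> simp [hp, h, hf]

theorem prob_not [Nonempty Ω] (p : Ω → Prop) : prob (fun ω => ¬ p ω) = 1 - prob p := by
  unfold prob
  rw [eq_sub_iff_add_eq, ← Finset.expect_add_distrib, ← Fintype.expect_one (ι := Ω)]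
  refine Finset.expect_congr rfl fun ω _ => ?_
  by_cases hp : p ω <;> simp [hp]

theorem sq_expect_abs_le (f : Ω → ℝ) : (𝔼 ω, |f ω|) ^ 2 ≤ 𝔼 ω, f ω ^ 2 := by
  rcases isEmpty_or_nonempty Ω with h | h
  · simp
  set μ := 𝔼 ω, |f ω|
  have h0 : 0 ≤ 𝔼 ω, (|f ω| - μ) ^ 2 := Finset.expect_nonneg fun ω _ => sq_nonneg _
  have h1 : 𝔼 ω, (|f ω| - μ) ^ 2 = 𝔼 ω, f ω ^ 2 - 2 * μ * μ + μ ^ 2 := by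
    rw [← Fintype.expect_const (ι := Ω) (μ ^ 2)]
    nth_rewrite 3 [show μ = 𝔼 ω, |f ω| from rfl]
    rw [Finset.mul_expect, ← Finset.expect_sub_distrib, ← Finset.expect_add_distrib]
    refine Finset.expect_congr rfl fun ω _ => ?_
    rw [← sq_abs (f ω)]
    ring
  nlinarith

end prob

/-! ### The Gram form of a random sign matrix -/

variable {n r : ℕ}

/-- The inner product of the images of `x` and `y` under the rescaled sign matrix with
columns `ω l`. -/
noncomputable def gram (ω : Fin r → Fin n → Bool) (x y : EuclideanSpace ℝ (Fin n)) : ℝ :=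
  (∑ l, radSum (ω l) x * radSum (ω l) y) / r

theorem radSum_add (s : Fin n → Bool) (x y : EuclideanSpace ℝ (Fin n)) :
    radSum s (x + y : EuclideanSpace ℝ (Fin n)) = radSum s x + radSum s y := by
  simp [radSum, add_mul, Finset.sum_add_distrib]

theorem radSum_smul (s : Fin n → Bool) (c : ℝ) (x : EuclideanSpace ℝ (Fin n)) :
    radSum s (c • x : EuclideanSpace ℝ (Fin n)) = c * radSum s x := by
  simp [radSum, Finset.mul_sum, mul_assoc]

theorem gram_add_left (ω : Fin r → Fin n → Bool) (x y z : EuclideanSpace ℝ (Fin n)) :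
    gram ω (x + y) z = gram ω x z + gram ω y z := by
  simp only [gram, radSum_add, add_mul, Finset.sum_add_distrib, add_div]

theorem gram_smul_left (ω : Fin r → Fin n → Bool) (c : ℝ) (x z : EuclideanSpace ℝ (Fin n)) :
    gram ω (c • x) z = c * gram ω x z := by
  simp only [gram, radSum_smul, mul_assoc, ← Finset.mul_sum, mul_div_assoc]

theorem gram_comm (ω : Fin r → Fin n → Bool) (x y : EuclideanSpace ℝ (Fin n)) :
    gram ω x y = gram ω y x := by
  simp only [gram, mul_comm]

theorem gram_self_nonneg (ω : Fin r → Fin n → Bool) (x : EuclideanSpace ℝ (Fin n)) :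
    0 ≤ gram ω x x :=
  div_nonneg (Finset.sum_nonneg fun _ _ => mul_self_nonneg _) (Nat.cast_nonneg _)

/-- The Gram form as a bilinear map. -/
noncomputable def gramForm (ω : Fin r → Fin n → Bool) :
    EuclideanSpace ℝ (Fin n) →ₗ[ℝ] EuclideanSpace ℝ (Fin n) →ₗ[ℝ] ℝ :=
  LinearMap.mk₂ ℝ (gram ω) (gram_add_left ω) (gram_smul_left ω)
    (fun x y z => by rw [gram_comm, gram_add_left, gram_comm ω y, gram_comm ω z])
    (fun c x y => by rw [gram_comm, gram_smul_left, gram_comm ω y, smul_eq_mul])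

@[simp] theorem gramForm_apply (ω : Fin r → Fin n → Bool) (x y : EuclideanSpace ℝ (Fin n)) :
    gramForm ω x y = gram ω x y := rfl

theorem sum_sq_eq_norm_sq (x : EuclideanSpace ℝ (Fin n)) : ∑ j, x j ^ 2 = ‖x‖ ^ 2 :=
  (EuclideanSpace.real_norm_sq_eq x).symm

theorem sum_mul_eq_inner (x y : EuclideanSpace ℝ (Fin n)) :
    ∑ j, x j * y j = inner ℝ x y := by
  simp [PiLp.inner_apply, mul_comm]

/-- The Gram form is an average of r independent copies with mean ⟨x, y⟩, so its variance is 1/r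
times that of one copy, which the fourth moments bound. -/
theorem expect_gram_sub_inner_sq_le (hr : 0 < r) (x y : EuclideanSpace ℝ (Fin n)) :
    𝔼 ω : Fin r → Fin n → Bool, (gram ω x y - inner ℝ x y) ^ 2 ≤
      3 / r * (‖x‖ ^ 2 * ‖y‖ ^ 2) := by
  have hr' : (0 : ℝ) < r := by exact_mod_cast hr
  set z : (Fin n → Bool) → ℝ := fun s => radSum s x * radSum s y - inner ℝ x y with hz
  have hmean : 𝔼 s : Fin n → Bool, radSum s x * radSum s y = inner ℝ x y := by
    rw [expect_radSum_mul, sum_mul_eq_inner]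
  have hz0 : 𝔼 s, z s = 0 := by
    rw [hz, Finset.expect_sub_distrib, hmean, Fintype.expect_const, sub_self]
  have e1 : ∀ ω : Fin r → Fin n → Bool,
      (gram ω x y - inner ℝ x y) ^ 2 = 1 / r ^ 2 * (∑ l, z (ω l)) ^ 2 := by
    intro ω
    simp only [hz, gram, Finset.sum_sub_distrib, Finset.sum_const, Finset.card_univ,
      Fintype.card_fin, nsmul_eq_mul]
    field_simp
  have e2 : 𝔼 s, z s ^ 2 ≤ 𝔼 s : Fin n → Bool, (radSum s x * radSum s y) ^ 2 := by
    have : 𝔼 s, z s ^ 2 = 𝔼 s : Fin n → Bool, (radSum s x * radSum s y) ^ 2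
        - 2 * (inner ℝ x y) * inner ℝ x y + (inner ℝ x y) ^ 2 := by
      rw [← Fintype.expect_const (ι := Fin n → Bool) ((inner ℝ x y : ℝ) ^ 2)]
      nth_rewrite 2 [← hmean]
      rw [Finset.mul_expect, ← Finset.expect_sub_distrib, ← Finset.expect_add_distrib]
      refine Finset.expect_congr rfl fun s _ => ?_
      simp only [hz]
      ring
    rw [this]
    nlinarith [sq_nonneg (inner ℝ x y : ℝ)]
  have e3 : 𝔼 s : Fin n → Bool, (radSum s x * radSum s y) ^ 2 ≤ 3 * (‖x‖ ^ 2 * ‖y‖ ^ 2) := by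
    have hx := expect_radSum_pow_four_le x.ofLp
    have hy := expect_radSum_pow_four_le y.ofLp
    rw [sum_sq_eq_norm_sq] at hx hy
    rcases eq_or_ne x 0 with rfl | hx0
    · simp [radSum]
    rcases eq_or_ne y 0 with rfl | hy0
    · simp [radSum]
    have hx1 : 0 < ‖x‖ ^ 2 := by positivity
    have hy1 : 0 < ‖y‖ ^ 2 := by positivity
    set a := ‖x‖ ^ 2
    set b := ‖y‖ ^ 2
    -- AM-GM for X²Y², weighted so that the two fourth moments contribute equally, 3ab/2 each.
    have h1 : 𝔼 s : Fin n → Bool, (radSum s x * radSum s y) ^ 2 ≤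
        b / (2 * a) * 𝔼 s : Fin n → Bool, radSum s x ^ 4
          + a / (2 * b) * 𝔼 s : Fin n → Bool, radSum s y ^ 4 := by
      rw [Finset.mul_expect, Finset.mul_expect, ← Finset.expect_add_distrib]
      refine Finset.expect_le_expect fun s _ => ?_
      set X := radSum s x
      set Y := radSum s y
      have : b / (2 * a) * X ^ 4 + a / (2 * b) * Y ^ 4 - (X * Y) ^ 2
          = (b * X ^ 2 - a * Y ^ 2) ^ 2 / (2 * a * b) := by
        field_simp
        ring
      have h2 : 0 ≤ (b * X ^ 2 - a * Y ^ 2) ^ 2 / (2 * a * b) := by positivity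
      linarith
    calc _ ≤ _ := h1
      _ ≤ b / (2 * a) * (3 * a ^ 2) + a / (2 * b) * (3 * b ^ 2) := by gcongr
      _ = 3 * (a * b) := by field_simp; ring
  simp only [e1]
  rw [← Finset.mul_expect, expect_sum_copies_sq r z hz0]
  calc 1 / (r : ℝ) ^ 2 * (r * 𝔼 s, z s ^ 2)
      ≤ 1 / (r : ℝ) ^ 2 * (r * (3 * (‖x‖ ^ 2 * ‖y‖ ^ 2))) := by
        gcongr
        exact e2.trans e3
    _ = _ := by field_simp

theorem prob_gram_deviation_le (hr : 0 < r) (x : EuclideanSpace ℝ (Fin n)) {ε : ℝ} (hε : 0 < ε)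
    (hε' : ε ≤ 1 / 2) :
    prob (fun ω : Fin r → Fin n → Bool => ¬ |gram ω x x - ‖x‖ ^ 2| ≤ ε * ‖x‖ ^ 2) ≤
      2 * Real.exp (-(r * ε ^ 2 / 8)) := by
  have hr' : (0 : ℝ) < r := by exact_mod_cast hr
  rcases eq_or_ne x 0 with rfl | hx0
  · simp [gram, radSum, prob]
    positivity
  have hv : 0 < ‖x‖ ^ 2 := by positivity
  have hsum := sum_sq_eq_norm_sq x
  set v := ‖x‖ ^ 2
  -- The Chernoff exponent per column is 2(tv)² - ε(tv); it is minimal at tv = ε/4, with value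
  -- -ε²/8. The condition tv ≤ 1/8 is ε ≤ 1/2.
  set t := ε / (4 * v) with ht
  have ht0 : 0 < t := by positivity
  have htv : t * v = ε / 4 := by rw [ht]; field_simp
  have hup := expect_exp_mul_radSum_sq_le x.ofLp t ht0.le (by rw [hsum, htv]; linarith)
  have hlo := expect_exp_neg_mul_radSum_sq_le x.ofLp t ht0.le
  rw [hsum, htv] at hup hlo
  have hg : ∀ ω : Fin r → Fin n → Bool, ∑ l, radSum (ω l) x ^ 2 = r * gram ω x x := by
    intro ω
    simp only [gram, sq]
    field_simp
  have up : prob (fun ω : Fin r → Fin n → Bool => (1 + ε) * v ≤ gram ω x x) ≤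
      Real.exp (-(r * ε ^ 2 / 8)) := by
    have h1 := mul_prob_le_expect (p := fun ω : Fin r → Fin n → Bool => (1 + ε) * v ≤ gram ω x x)
      (f := fun ω => ∏ l, Real.exp (t * radSum (ω l) x ^ 2))
      (a := Real.exp (t * (r * ((1 + ε) * v))))
      (fun ω => Finset.prod_nonneg fun l _ => Real.exp_nonneg _)
      (fun ω hω => by
        rw [← Real.exp_sum, ← Finset.mul_sum, hg]
        gcongr)
    -- Independence of the r columns: the expectation of the product is the r-th power of one
    -- expectation.
    have h2 := Finset.expect_pow Finset.univ (fun s : Fin n → Bool => Real.exp (t * radSum s x ^ 2)) r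
    rw [Fintype.piFinset_univ] at h2
    rw [← h2] at h1
    have h3 : (𝔼 s : Fin n → Bool, Real.exp (t * radSum s x ^ 2)) ^ r ≤
        Real.exp (r * (ε / 4 + 2 * (ε / 4) ^ 2)) := by
      rw [Real.exp_nat_mul]
      exact pow_le_pow_left₀ (Finset.expect_nonneg fun s _ => Real.exp_nonneg _) hup r
    have h4 := h1.trans h3
    rw [← le_div_iff₀' (Real.exp_pos _), ← Real.exp_sub] at h4
    refine h4.trans (le_of_eq ?_)
    congr 1
    rw [show t * (r * ((1 + ε) * v)) = r * (1 + ε) * (t * v) by ring, htv]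
    ring
  have lo : prob (fun ω : Fin r → Fin n → Bool => gram ω x x ≤ (1 - ε) * v) ≤
      Real.exp (-(r * ε ^ 2 / 8)) := by
    have h1 := mul_prob_le_expect (p := fun ω : Fin r → Fin n → Bool => gram ω x x ≤ (1 - ε) * v)
      (f := fun ω => ∏ l, Real.exp (-(t * radSum (ω l) x ^ 2)))
      (a := Real.exp (-(t * (r * ((1 - ε) * v)))))
      (fun ω => Finset.prod_nonneg fun l _ => Real.exp_nonneg _)
      (fun ω hω => by
        rw [← Real.exp_sum, Finset.sum_neg_distrib, ← Finset.mul_sum, hg]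
        gcongr)
    have h2 := Finset.expect_pow Finset.univ
      (fun s : Fin n → Bool => Real.exp (-(t * radSum s x ^ 2))) r
    rw [Fintype.piFinset_univ] at h2
    rw [← h2] at h1
    have h3 : (𝔼 s : Fin n → Bool, Real.exp (-(t * radSum s x ^ 2))) ^ r ≤
        Real.exp (r * (-(ε / 4) + 2 * (ε / 4) ^ 2)) := by
      rw [Real.exp_nat_mul]
      exact pow_le_pow_left₀ (Finset.expect_nonneg fun s _ => Real.exp_nonneg _) hlo r
    have h4 := h1.trans h3
    rw [← le_div_iff₀' (Real.exp_pos _), ← Real.exp_sub] at h4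
    refine h4.trans (le_of_eq ?_)
    congr 1
    rw [show t * (r * ((1 - ε) * v)) = r * (1 - ε) * (t * v) by ring, htv]
    ring
  calc _ ≤ prob (fun ω : Fin r → Fin n → Bool =>
          (1 + ε) * v ≤ gram ω x x ∨ gram ω x x ≤ (1 - ε) * v) := by
        refine prob_mono fun ω hω => ?_
        by_contra! h
        exact hω (abs_le.2 ⟨by linarith, by linarith⟩)
    _ ≤ _ := prob_or_le _ _
    _ ≤ _ := by linarith

/-! ### Nets -/

/-- Greedy argument: a 1-separated subset of the ball of radius 2 has at most 5^d points. If no such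
set were a net, each could be enlarged by a point, giving separated sets of every size. -/
theorem exists_net (E : Type*) [NormedAddCommGroup E] [NormedSpace ℝ E] [FiniteDimensional ℝ E] :
    ∃ N : Finset E, N.card ≤ 5 ^ Module.finrank ℝ E ∧ (∀ x ∈ N, ‖x‖ ≤ 2) ∧
      ∀ x : E, ‖x‖ ≤ 2 → ∃ y ∈ N, ‖x - y‖ ≤ 1 := by
  classical
  by_contra! H
  have key : ∀ d : ℕ, ∃ N : Finset E, N.card = d ∧ (∀ x ∈ N, ‖x‖ ≤ 2) ∧
      ∀ c ∈ N, ∀ d ∈ N, c ≠ d → 1 ≤ ‖c - d‖ := by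
    intro d
    induction d with
    | zero => exact ⟨∅, by simp⟩
    | succ d ih =>
      obtain ⟨N, hc, hN, hs⟩ := ih
      obtain ⟨x, hx, hxN⟩ := H N (Besicovitch.card_le_of_separated N hN hs) hN
      have hx' : x ∉ N := fun h => by simpa using (hxN x h).le.trans_lt' one_pos
      refine ⟨insert x N, by rw [Finset.card_insert_of_notMem hx', hc], ?_, ?_⟩
      · intro y hy
        rcases Finset.mem_insert.1 hy with rfl | hy
        exacts [hx, hN y hy]
      · intro a ha b hb hab
        rcases Finset.mem_insert.1 ha with rfl | ha' <;>
          rcases Finset.mem_insert.1 hb with rfl | hb'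
        · exact absurd rfl hab
        · exact (hxN b hb').le
        · rw [norm_sub_rev]
          exact (hxN a ha').le
        · exact hs a ha' b hb' hab
  obtain ⟨N, hc, hN, hs⟩ := key (5 ^ Module.finrank ℝ E + 1)
  have := Besicovitch.card_le_of_separated N hN hs
  omega

/-- A vector of norm 2 is a net point plus a vector of norm at most 1, so 2‖f‖ ≤ B + ‖f‖, and the
unknown operator norm can be absorbed on the left. -/
theorem abs_le_of_net {E : Type*} [NormedAddCommGroup E] [NormedSpace ℝ E]
    [FiniteDimensional ℝ E] {N : Finset E} (hN : ∀ x : E, ‖x‖ ≤ 2 → ∃ y ∈ N, ‖x - y‖ ≤ 1)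
    (f : E →ₗ[ℝ] ℝ) {B : ℝ} (hf : ∀ y ∈ N, |f y| ≤ B) (x : E) : |f x| ≤ B * ‖x‖ := by
  set φ := LinearMap.toContinuousLinearMap f with hφ
  have hφf : ∀ x, φ x = f x := fun _ => rfl
  have hB : 0 ≤ B := by
    obtain ⟨y, hy, -⟩ := hN 0 (by simp)
    exact (abs_nonneg _).trans (hf y hy)
  have h1 : ∀ x, ‖φ x‖ ≤ (B + ‖φ‖) / 2 * ‖x‖ := by
    intro x
    rcases eq_or_ne x 0 with rfl | hx
    · simp
    have hx' : 0 < ‖x‖ := norm_pos_iff.2 hx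
    set z := (2 / ‖x‖) • x with hz
    have hzn : ‖z‖ = 2 := by
      rw [hz, norm_smul, Real.norm_of_nonneg (by positivity)]
      field_simp
    obtain ⟨y, hy, hzy⟩ := hN z hzn.le
    have h2 : ‖φ z‖ ≤ B + ‖φ‖ := by
      calc ‖φ z‖ = ‖φ y + φ (z - y)‖ := by rw [← map_add]; congr 2; abel
        _ ≤ ‖φ y‖ + ‖φ (z - y)‖ := norm_add_le _ _
        _ ≤ B + ‖φ‖ * 1 := by
          refine add_le_add (hf y hy) ((φ.le_opNorm _).trans ?_)
          gcongr
        _ = _ := by rw [mul_one]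
    rw [hz, map_smul, norm_smul, Real.norm_of_nonneg (by positivity)] at h2
    rw [div_mul_eq_mul_div, div_le_iff₀ hx'] at h2
    linarith
  have h2 := φ.opNorm_le_bound (by positivity) h1
  have h3 : ‖φ‖ ≤ B := by linarith
  exact (φ.le_opNorm x).trans (by gcongr)

/-- Polarization turns the norm deviations at x ± y into a bound for the bilinear form at pairs of
net points; by the parallelogram law ‖x + y‖² + ‖x - y‖² ≤ 16, which gives 4ε. The net argument then
applies to each variable in turn. -/
theorem abs_gram_sub_inner_le_of_net
    {U : Submodule ℝ (EuclideanSpace ℝ (Fin n))} {M : Finset U}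
    (hM : ∀ x ∈ M, ‖x‖ ≤ 2) (hnet : ∀ x : U, ‖x‖ ≤ 2 → ∃ y ∈ M, ‖x - y‖ ≤ 1)
    (ω : Fin r → Fin n → Bool) {ε : ℝ} (hε : 0 ≤ ε)
    (h : ∀ x ∈ M, ∀ y ∈ M,
      |gram ω (x + y : U) (x + y : U) - ‖((x + y : U) : EuclideanSpace ℝ (Fin n))‖ ^ 2| ≤
        ε * ‖((x + y : U) : EuclideanSpace ℝ (Fin n))‖ ^ 2 ∧
      |gram ω (x - y : U) (x - y : U) - ‖((x - y : U) : EuclideanSpace ℝ (Fin n))‖ ^ 2| ≤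
        ε * ‖((x - y : U) : EuclideanSpace ℝ (Fin n))‖ ^ 2)
    (x y : U) : |gram ω x y - inner ℝ (x : EuclideanSpace ℝ (Fin n)) y| ≤ 4 * ε * ‖x‖ * ‖y‖ := by
  set S : U →ₗ[ℝ] U →ₗ[ℝ] ℝ := (gramForm ω).domRestrict₁₂ U U - innerₗ U with hS
  have hSxy : ∀ x y : U, S x y = gram ω x y - inner ℝ (x : EuclideanSpace ℝ (Fin n)) y :=
    fun x y => rfl
  have hsymm : ∀ x y, S x y = S y x := by
    intro x y
    rw [hSxy, hSxy, gram_comm, real_inner_comm]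
  have hself : ∀ z : U, S z z = gram ω z z - ‖(z : EuclideanSpace ℝ (Fin n))‖ ^ 2 := by
    intro z
    rw [hSxy, real_inner_self_eq_norm_sq]
  have h1 : ∀ x ∈ M, ∀ y ∈ M, |S x y| ≤ 4 * ε := by
    intro x hx y hy
    obtain ⟨hp, hm⟩ := h x hx y hy
    rw [← hself] at hp hm
    have e : 4 * S x y = S (x + y) (x + y) - S (x - y) (x - y) := by
      simp only [map_add, map_sub, LinearMap.add_apply, LinearMap.sub_apply, hsymm y x]
      ring
    have hpar := parallelogram_law_with_norm ℝ (x : EuclideanSpace ℝ (Fin n)) y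
    have hx2 : ‖(x : EuclideanSpace ℝ (Fin n))‖ ≤ 2 := hM x hx
    have hy2 : ‖(y : EuclideanSpace ℝ (Fin n))‖ ≤ 2 := hM y hy
    have hx3 := mul_self_le_mul_self (norm_nonneg _) hx2
    have hy3 := mul_self_le_mul_self (norm_nonneg _) hy2
    have hle : |4 * S x y| ≤ ε * 16 := by
      rw [e]
      refine (abs_sub _ _).trans ((add_le_add hp hm).trans ?_)
      rw [← mul_add]
      refine mul_le_mul_of_nonneg_left ?_ hε
      push_cast
      nlinarith
    rw [abs_mul, abs_of_pos (by norm_num : (0 : ℝ) < 4)] at hle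
    linarith
  have h2 : ∀ x ∈ M, ∀ y, |S y x| ≤ 4 * ε * ‖y‖ := fun x hx y => by
    rw [hsymm]
    exact abs_le_of_net hnet (S x) (h1 x hx) y
  rw [← hSxy, hsymm, mul_right_comm, hsymm]
  exact abs_le_of_net hnet (S x) (fun z hz => h2 z hz x) y |>.trans (le_of_eq (by ring))

/-- Union bound: at most (5^d)² pairs of net points, two vectors x ± y for each pair, and a
two-sided tail of 2 exp(-rε²/8) for each vector. -/
theorem prob_not_isometry_le (hr : 0 < r) (U : Submodule ℝ (EuclideanSpace ℝ (Fin n))) {ε : ℝ}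
    (hε : 0 < ε) (hε' : ε ≤ 1 / 2) :
    prob (fun ω : Fin r → Fin n → Bool =>
      ¬ ∀ z ∈ U, (1 - 4 * ε) * ‖z‖ ^ 2 ≤ gram ω z z) ≤
      4 * 25 ^ Module.finrank ℝ U * Real.exp (-(r * ε ^ 2 / 8)) := by
  classical
  obtain ⟨M, hcard, hM, hnet⟩ := exists_net U
  set p : EuclideanSpace ℝ (Fin n) → (Fin r → Fin n → Bool) → Prop :=
    fun x ω => ¬ |gram ω x x - ‖x‖ ^ 2| ≤ ε * ‖x‖ ^ 2 with hp
  have hbound : ∀ x, prob (p x) ≤ 2 * Real.exp (-(r * ε ^ 2 / 8)) := fun x =>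
    prob_gram_deviation_le hr x hε hε'
  calc _ ≤ prob (fun ω => ∃ xy ∈ M ×ˢ M, p (xy.1 + xy.2 : U) ω ∨ p (xy.1 - xy.2 : U) ω) := by
        refine prob_mono fun ω hω => ?_
        by_contra! hcon
        refine hω fun z hz => ?_
        have := abs_gram_sub_inner_le_of_net hM hnet ω hε.le (fun x hx y hy => by
          have := hcon (x, y) (Finset.mk_mem_product hx hy)
          simpa only [hp, not_not] using this) ⟨z, hz⟩ ⟨z, hz⟩
        rw [real_inner_self_eq_norm_sq] at this
        have := (abs_le.1 this).1
        simp only [Submodule.coe_norm] at this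
        nlinarith
    _ ≤ ∑ xy ∈ M ×ˢ M, prob (fun ω => p (xy.1 + xy.2 : U) ω ∨ p (xy.1 - xy.2 : U) ω) :=
        prob_exists_le _ _
    _ ≤ ∑ xy ∈ M ×ˢ M, 4 * Real.exp (-(r * ε ^ 2 / 8)) := by
        refine Finset.sum_le_sum fun xy _ => (prob_or_le _ _).trans ?_
        linarith [hbound (xy.1 + xy.2 : U), hbound (xy.1 - xy.2 : U)]
    _ = (M.card : ℝ) ^ 2 * (4 * Real.exp (-(r * ε ^ 2 / 8))) := by
        rw [Finset.sum_const, Finset.card_product, nsmul_eq_mul]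
        push_cast
        ring
    _ ≤ ((5 : ℝ) ^ Module.finrank ℝ U) ^ 2 * (4 * Real.exp (-(r * ε ^ 2 / 8))) := by
        gcongr
        exact_mod_cast hcard
    _ = _ := by
        rw [← pow_mul, mul_comm _ 2, pow_mul]
        norm_num
        ring

end Rademacher

/-! ### Second-moment events and the deterministic comparison of norms -/

namespace Rademacher

variable {n r : ℕ}

/-- Markov's inequality for the sum of the absolute deviations; each has mean at most √(3/r)‖b i‖²
by the variance bound. No union over the m points is needed. -/
theorem prob_not_sum_gram_le (hr : 0 < r) {m : ℕ} (b : Fin m → EuclideanSpace ℝ (Fin n))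
    {ε : ℝ} (hε : 0 < ε) :
    prob (fun ω : Fin r → Fin n → Bool =>
      ¬ ∑ i, gram ω (b i) (b i) ≤ (1 + ε) * ∑ i, ‖b i‖ ^ 2) ≤ √(3 / r) / ε := by
  have hS0 : 0 ≤ ∑ i, ‖b i‖ ^ 2 := Finset.sum_nonneg fun _ _ => sq_nonneg _
  rcases hS0.eq_or_lt with h0 | hS
  · have hb : ∀ i, b i = 0 := fun i => by
      have := (Finset.sum_eq_zero_iff_of_nonneg fun _ _ => sq_nonneg _).1 h0.symm i
        (Finset.mem_univ i)
      simpa using this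
    simp only [hb, gram, radSum, prob]
    simp
    positivity
  · set S := ∑ i, ‖b i‖ ^ 2
    have h1 := mul_prob_le_expect
      (p := fun ω : Fin r → Fin n → Bool => ¬ ∑ i, gram ω (b i) (b i) ≤ (1 + ε) * S)
      (f := fun ω => ∑ i, |gram ω (b i) (b i) - inner ℝ (b i) (b i)|) (a := ε * S)
      (fun ω => Finset.sum_nonneg fun _ _ => abs_nonneg _)
      (fun ω hω => by
        have : ∑ i, (gram ω (b i) (b i) - inner ℝ (b i) (b i)) = ∑ i, gram ω (b i) (b i) - S := by
          rw [Finset.sum_sub_distrib]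
          simp only [real_inner_self_eq_norm_sq, S]
        have h2 := Finset.sum_le_sum fun i (_ : i ∈ Finset.univ) =>
          le_abs_self (gram ω (b i) (b i) - inner ℝ (b i) (b i))
        rw [this] at h2
        push Not at hω
        linarith)
    have h2 : ∀ i, 𝔼 ω : Fin r → Fin n → Bool, |gram ω (b i) (b i) - inner ℝ (b i) (b i)| ≤
        √(3 / r) * ‖b i‖ ^ 2 := by
      intro i
      have h := (sq_expect_abs_le _).trans (expect_gram_sub_inner_sq_le hr (b i) (b i))
      refine (Real.le_sqrt_of_sq_le h).trans (le_of_eq ?_)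
      rw [Real.sqrt_mul (by positivity), Real.sqrt_mul_self (by positivity)]
    have h3 : ε * S * prob (fun ω : Fin r → Fin n → Bool =>
        ¬ ∑ i, gram ω (b i) (b i) ≤ (1 + ε) * S) ≤ √(3 / r) * S := by
      refine h1.trans ?_
      rw [Finset.expect_sum_comm, Finset.mul_sum]
      exact Finset.sum_le_sum fun i _ => h2 i
    rw [le_div_iff₀ hε]
    refine le_of_mul_le_mul_right ?_ hS
    linarith

/-- Each basis vector of U is orthogonal to each w p, so the variance bound controls the plain
second moment of their Gram product. Summing over the basis costs a factor dim U, and Markov's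
inequality finishes. -/
theorem prob_not_sum_cross_le (hr : 0 < r) {m : ℕ} (U : Submodule ℝ (EuclideanSpace ℝ (Fin n)))
    (w : Fin m → EuclideanSpace ℝ (Fin n)) (hw : ∀ p, w p ∈ Uᗮ) {ε : ℝ} (hε : 0 < ε) :
    prob (fun ω : Fin r → Fin n → Bool =>
      ¬ ∑ p, ∑ v, gram ω (stdOrthonormalBasis ℝ U v) (w p) ^ 2 ≤ ε ^ 2 * ∑ p, ‖w p‖ ^ 2) ≤
      3 * Module.finrank ℝ U / (r * ε ^ 2) := by
  have hr' : (0 : ℝ) < r := by exact_mod_cast hr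
  have hS0 : 0 ≤ ∑ i, ‖w i‖ ^ 2 := Finset.sum_nonneg fun _ _ => sq_nonneg _
  rcases hS0.eq_or_lt with h0 | hS
  · have hb : ∀ i, w i = 0 := fun i => by
      have := (Finset.sum_eq_zero_iff_of_nonneg fun _ _ => sq_nonneg _).1 h0.symm i
        (Finset.mem_univ i)
      simpa using this
    simp only [hb, gram, radSum, prob]
    simp
    positivity
  · set S := ∑ i, ‖w i‖ ^ 2 with hSdef
    have h1 := mul_prob_le_expect
      (p := fun ω : Fin r → Fin n → Bool =>
        ¬ ∑ p, ∑ v, gram ω (stdOrthonormalBasis ℝ U v) (w p) ^ 2 ≤ ε ^ 2 * S)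
      (f := fun ω => ∑ p, ∑ v, gram ω (stdOrthonormalBasis ℝ U v) (w p) ^ 2) (a := ε ^ 2 * S)
      (fun ω => Finset.sum_nonneg fun _ _ => Finset.sum_nonneg fun _ _ => sq_nonneg _)
      (fun ω hω => (not_le.1 hω).le)
    have h2 : 𝔼 ω : Fin r → Fin n → Bool,
        ∑ p, ∑ v, gram ω (stdOrthonormalBasis ℝ U v) (w p) ^ 2 ≤
        3 * Module.finrank ℝ U / r * S := by
      rw [Finset.expect_sum_comm, hSdef, Finset.mul_sum]
      refine Finset.sum_le_sum fun p _ => ?_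
      rw [Finset.expect_sum_comm]
      calc ∑ v, 𝔼 ω : Fin r → Fin n → Bool, gram ω (stdOrthonormalBasis ℝ U v) (w p) ^ 2
          ≤ ∑ _v : Fin (Module.finrank ℝ U), 3 / r * ‖w p‖ ^ 2 := by
            refine Finset.sum_le_sum fun v _ => ?_
            have h := expect_gram_sub_inner_sq_le hr
              (stdOrthonormalBasis ℝ U v : EuclideanSpace ℝ (Fin n)) (w p)
            have hin : inner ℝ (stdOrthonormalBasis ℝ U v : EuclideanSpace ℝ (Fin n)) (w p) = 0 :=
              Submodule.inner_right_of_mem_orthogonal (SetLike.coe_mem _) (hw p)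
            have hn : ‖(stdOrthonormalBasis ℝ U v : EuclideanSpace ℝ (Fin n))‖ = 1 :=
              (stdOrthonormalBasis ℝ U).norm_eq_one v
            simpa only [hin, hn, sub_zero, one_pow, one_mul] using h
        _ = 3 * Module.finrank ℝ U / r * ‖w p‖ ^ 2 := by
            rw [Finset.sum_const, Finset.card_univ, Fintype.card_fin, nsmul_eq_mul]
            ring
    have h3 := h1.trans h2
    rw [le_div_iff₀ (by positivity)]
    refine le_of_mul_le_mul_right ?_ hS
    have : 3 * (Module.finrank ℝ U : ℝ) * S = r * (3 * Module.finrank ℝ U / r * S) := by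
      field_simp
    rw [this]
    refine le_trans (le_of_eq ?_) (mul_le_mul_of_nonneg_left h3 hr'.le)
    ring

theorem gram_sq_le (ω : Fin r → Fin n → Bool) (U : Submodule ℝ (EuclideanSpace ℝ (Fin n)))
    (z : U) (w : EuclideanSpace ℝ (Fin n)) :
    gram ω z w ^ 2 ≤ ‖z‖ ^ 2 * ∑ v, gram ω (stdOrthonormalBasis ℝ U v) w ^ 2 := by
  set e := stdOrthonormalBasis ℝ U
  have h1 : gram ω z w = ∑ v, inner ℝ (e v) z * gram ω (e v) w := by
    have hz : (z : EuclideanSpace ℝ (Fin n))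
        = ∑ v, (inner ℝ (e v) z : ℝ) • (e v : EuclideanSpace ℝ (Fin n)) := by
      conv_lhs => rw [← e.sum_repr' z]
      push_cast
      rfl
    calc gram ω z w = (gramForm ω).flip w z := rfl
      _ = _ := by
        rw [hz, map_sum]
        refine Finset.sum_congr rfl fun v _ => ?_
        rw [map_smul]
        rfl
  rw [h1, ← e.sum_sq_inner_right]
  exact Finset.sum_mul_sq_le_sq_mul_sq _ _ _

/-! ### Symmetric idempotent matrices acting on families of vectors -/

section Family

variable {m : ℕ} {E : Type*} [AddCommGroup E] [Module ℝ E]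

/-- The family of vectors obtained by applying a matrix to a family of vectors. -/
def rowApply (D : Matrix (Fin m) (Fin m) ℝ) (x : Fin m → E) (i : Fin m) : E := ∑ p, D i p • x p

/-- Used for the inner product, where it makes D a contraction, and for the Gram form, where it
moves D away from the residuals. -/
theorem sum_form_rowApply {D : Matrix (Fin m) (Fin m) ℝ} (hD : D.transpose = D)
    (B : E →ₗ[ℝ] E →ₗ[ℝ] ℝ) (u y : Fin m → E) :
    ∑ i, B (u i) (rowApply D y i) = ∑ p, B (rowApply D u p) (y p) := by
  simp only [rowApply, map_sum, map_smul, LinearMap.sum_apply, LinearMap.smul_apply]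
  rw [Finset.sum_comm]
  refine Finset.sum_congr rfl fun p _ => Finset.sum_congr rfl fun i _ => ?_
  conv_lhs => rw [← hD]
  rfl

theorem rowApply_rowApply {D : Matrix (Fin m) (Fin m) ℝ} (hD : D * D = D) (x : Fin m → E) :
    rowApply D (rowApply D x) = rowApply D x := by
  ext i
  simp only [rowApply, Finset.smul_sum, smul_smul]
  rw [Finset.sum_comm]
  refine Finset.sum_congr rfl fun p _ => ?_
  rw [← Finset.sum_smul]
  conv_rhs => rw [← hD]
  rfl

theorem map_rowApply {F : Type*} [AddCommGroup F] [Module ℝ F] (D : Matrix (Fin m) (Fin m) ℝ)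
    (f : E →ₗ[ℝ] F) (x : Fin m → E) (i : Fin m) :
    f (rowApply D x i) = rowApply D (fun p => f (x p)) i := by
  simp [rowApply]

end Family

/-- Here ‖Dw‖² = ⟨Dw, w⟩ ≤ (‖Dw‖² + ‖w‖²)/2, with norms and inner product summed over the family. -/
theorem sum_norm_sq_rowApply_le {m : ℕ} {E : Type*} [NormedAddCommGroup E]
    [InnerProductSpace ℝ E] {D : Matrix (Fin m) (Fin m) ℝ} (hD : D.transpose = D)
    (hDD : D * D = D) (w : Fin m → E) : ∑ i, ‖rowApply D w i‖ ^ 2 ≤ ∑ i, ‖w i‖ ^ 2 := by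
  have h := sum_form_rowApply hD (innerₗ E) (rowApply D w) w
  rw [rowApply_rowApply hDD] at h
  simp only [innerₗ_apply_apply, real_inner_self_eq_norm_sq] at h
  have h2 : ∑ p, inner ℝ (rowApply D w p) (w p) ≤
      ∑ p, (‖rowApply D w p‖ ^ 2 + ‖w p‖ ^ 2) / 2 :=
    Finset.sum_le_sum fun p _ => (real_inner_le_norm _ _).trans
      (by nlinarith [sq_nonneg (‖rowApply D w p‖ - ‖w p‖)])
  rw [← Finset.sum_div, Finset.sum_add_distrib] at h2
  linarith

/-- If the Gram form of a sign matrix is almost isometric on `U` and almost orthogonal between `U`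
and the residuals of the points `a`, then the norm of `D a` is controlled by its Gram norm. -/
theorem sum_norm_sq_le_of_gram {m : ℕ} (ω : Fin r → Fin n → Bool)
    (U : Submodule ℝ (EuclideanSpace ℝ (Fin n))) {D : Matrix (Fin m) (Fin m) ℝ}
    (hD : D.transpose = D) (hDD : D * D = D) (a : Fin m → EuclideanSpace ℝ (Fin n)) {ε F : ℝ}
    (hε : 0 < ε) (hiso : ∀ z ∈ U, (1 - ε) * ‖z‖ ^ 2 ≤ gram ω z z)
    (hF : ∑ p, ‖a p - U.starProjection (a p)‖ ^ 2 ≤ F)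
    (hcross : ∑ p, ∑ v, gram ω (stdOrthonormalBasis ℝ U v) (a p - U.starProjection (a p)) ^ 2 ≤
      ε ^ 2 * ∑ p, ‖a p - U.starProjection (a p)‖ ^ 2) :
    ∃ α : ℝ, 0 ≤ α ∧ ∑ i, ‖rowApply D a i‖ ^ 2 ≤ α + F ∧
      (1 - 2 * ε) * α ≤ ∑ i, gram ω (rowApply D a i) (rowApply D a i) + ε * F := by
  set Q : EuclideanSpace ℝ (Fin n) →ₗ[ℝ] EuclideanSpace ℝ (Fin n) := U.starProjection.toLinearMap
    with hQ
  have hQe : ∀ x, U.starProjection x = Q x := fun _ => rfl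
  simp only [hQe] at hF hcross
  have hQU : ∀ x, Q x ∈ U := fun x => U.starProjection_apply_mem x
  set w : Fin m → EuclideanSpace ℝ (Fin n) := fun p => a p - Q (a p) with hw
  set b := rowApply D a with hb
  have hQb : ∀ i, Q (b i) = rowApply D (fun p => Q (a p)) i := map_rowApply D Q a
  have hbw : ∀ i, b i = Q (b i) + rowApply D w i := by
    intro i
    rw [hQb]
    simp [hb, hw, rowApply, smul_sub]
  have hww : ∀ i, rowApply D w i = b i - Q (b i) := fun i => by
    rw [eq_sub_iff_add_eq, add_comm, ← hbw]
  have hpyth : ∀ i, ‖b i‖ ^ 2 = ‖Q (b i)‖ ^ 2 + ‖rowApply D w i‖ ^ 2 := by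
    intro i
    have horth : inner ℝ (Q (b i)) (b i - Q (b i)) = 0 :=
      Submodule.inner_right_of_mem_orthogonal (hQU _) (U.sub_starProjection_mem_orthogonal (b i))
    have := norm_add_sq_eq_norm_sq_add_norm_sq_real horth
    rw [hww, sq, sq, sq, ← this, add_sub_cancel]
  -- α is the part of the norm of D a inside U; the part orthogonal to U is D w, and costs at most
  -- F.
  refine ⟨∑ i, ‖Q (b i)‖ ^ 2, Finset.sum_nonneg fun _ _ => sq_nonneg _, ?_, ?_⟩
  · simp only [hpyth, Finset.sum_add_distrib]
    have := sum_norm_sq_rowApply_le hD hDD w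
    simp only [hw] at this ⊢
    linarith
  -- D moves to the left argument, where it fixes the family Q b because D is idempotent and
  -- commutes with Q. What remains involves the fixed residuals w, to which `hcross` applies.
  · have hcr : ∑ i, gram ω (Q (b i)) (rowApply D w i) = ∑ p, gram ω (Q (b p)) (w p) := by
      have h := sum_form_rowApply hD (gramForm ω) (fun i => Q (b i)) w
      have h' : rowApply D (fun i => Q (b i)) = fun i => Q (b i) := by
        ext1 i
        rw [← map_rowApply, hb, rowApply_rowApply hDD]
      rw [h'] at h
      exact h
    set α := ∑ i, ‖Q (b i)‖ ^ 2 with hα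
    set H : Fin m → ℝ := fun p => ∑ v, gram ω (stdOrthonormalBasis ℝ U v) (w p) ^ 2 with hH
    have hHsum : ∑ p, H p ≤ ε ^ 2 * F :=
      hcross.trans (mul_le_mul_of_nonneg_left hF (sq_nonneg _))
    -- Cauchy–Schwarz gives g² ≤ qH, and (εq + H/ε)² ≥ 4qH. The weight ε is chosen because the H p
    -- sum to at most ε²F.
    have hterm : ∀ p, -(ε * ‖Q (b p)‖ ^ 2 + H p / ε) ≤ 2 * gram ω (Q (b p)) (w p) := by
      intro p
      have h1 := gram_sq_le ω U ⟨Q (b p), hQU _⟩ (w p)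
      simp only [Submodule.coe_norm] at h1
      set g := gram ω (Q (b p)) (w p)
      set q := ‖Q (b p)‖ ^ 2
      have hq : 0 ≤ q := sq_nonneg _
      have hHp : 0 ≤ H p := Finset.sum_nonneg fun _ _ => sq_nonneg _
      have h2 : (2 * g) ^ 2 ≤ (ε * q + H p / ε) ^ 2 := by
        have e : (ε * q + H p / ε) ^ 2 = (ε * q - H p / ε) ^ 2 + 4 * (q * H p) := by
          field_simp
          ring
        rw [e]
        nlinarith [sq_nonneg (ε * q - H p / ε)]
      exact (abs_le.1 (abs_le_of_sq_le_sq h2 (by positivity))).1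
    have hcross2 : -(ε * α + ε * F) ≤ 2 * ∑ p, gram ω (Q (b p)) (w p) := by
      have h1 := Finset.sum_le_sum fun p (_ : p ∈ Finset.univ) =>
        hterm p
      rw [Finset.sum_neg_distrib, Finset.sum_add_distrib, ← Finset.mul_sum, ← Finset.mul_sum,
        ← Finset.sum_div] at h1
      have h2 : (∑ p, H p) / ε ≤ ε * F := by
        rw [div_le_iff₀ hε]
        linarith
      linarith
    have hexp : ∀ i, gram ω (b i) (b i) = gram ω (Q (b i)) (Q (b i))
        + 2 * gram ω (Q (b i)) (rowApply D w i) + gram ω (rowApply D w i) (rowApply D w i) := by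
      intro i
      conv_lhs => rw [hbw i]
      rw [gram_add_left, gram_comm ω (Q (b i)) (_ + _), gram_comm ω (rowApply D w i) (_ + _),
        gram_add_left, gram_add_left, gram_comm ω (rowApply D w i) (Q (b i))]
      ring
    have h1 : (1 - ε) * α ≤ ∑ i, gram ω (Q (b i)) (Q (b i)) := by
      rw [hα, Finset.mul_sum]
      exact Finset.sum_le_sum fun i _ => hiso _ (hQU _)
    -- Only nonnegativity is needed here: the Gram norm of D w depends on the unknown clustering and
    -- is dropped.
    have h2 : 0 ≤ ∑ i, gram ω (rowApply D w i) (rowApply D w i) :=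
      Finset.sum_nonneg fun i _ => gram_self_nonneg _ _
    simp only [hexp, Finset.sum_add_distrib, ← Finset.mul_sum, hcr]
    linarith

end Rademacher

/-! ### Clusterings as projections, and the quality of the projected solution -/

namespace KMeans

open Rademacher

theorem IsIndicator.transpose_mul_self {m k : ℕ} {X : Matrix (Fin m) (Fin k) ℝ}
    (hX : IsIndicator X) : X.transpose * X = 1 := by
  obtain ⟨f, hf, hX⟩ := hX
  ext a b
  rw [Matrix.mul_apply]
  simp only [Matrix.transpose_apply, hX]
  rcases eq_or_ne a b with rfl | hab
  · rw [Matrix.one_apply_eq]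
    set s := (Finset.univ.filter (fun p => f p = a)).card with hs
    have hs0 : (0 : ℝ) < s := by
      obtain ⟨p, hp⟩ := hf a
      exact_mod_cast Finset.card_pos.2 ⟨p, by simp [hp]⟩
    have : ∀ i, (if f i = a then 1 / √(s : ℝ) else 0) * (if f i = a then 1 / √(s : ℝ) else 0)
        = if f i = a then 1 / (s : ℝ) else 0 := by
      intro i
      split_ifs
      · rw [div_mul_div_comm, Real.mul_self_sqrt hs0.le, one_mul]
      · simp
    simp only [this]
    rw [← Finset.sum_filter, Finset.sum_const, nsmul_eq_mul]
    convert mul_one_div_cancel hs0.ne'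
  · rw [Matrix.one_apply_ne hab]
    refine Finset.sum_eq_zero fun i _ => ?_
    by_cases h : f i = a
    · simp [h, hab]
    · simp [h]

/-- The complementary projection `1 - X Xᵀ` of a clustering. -/
def residual {m k : ℕ} (X : Matrix (Fin m) (Fin k) ℝ) : Matrix (Fin m) (Fin m) ℝ :=
  1 - X * X.transpose

theorem residual_transpose {m k : ℕ} (X : Matrix (Fin m) (Fin k) ℝ) :
    (residual X).transpose = residual X := by
  simp [residual, Matrix.transpose_mul]

theorem residual_mul_residual {m k : ℕ} {X : Matrix (Fin m) (Fin k) ℝ}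
    (hX : X.transpose * X = 1) : residual X * residual X = residual X := by
  have : X * X.transpose * (X * X.transpose) = X * X.transpose := by
    rw [Matrix.mul_assoc, ← Matrix.mul_assoc X.transpose, hX, Matrix.one_mul]
  simp [residual, mul_sub, sub_mul, this]

theorem cost_eq_frobSq {m n k : ℕ} (A : Matrix (Fin m) (Fin n) ℝ) (X : Matrix (Fin m) (Fin k) ℝ) :
    cost A X = frobSq (residual X * A) := by
  rw [cost, residual, Matrix.sub_mul, Matrix.one_mul]

/-- A row of a matrix as a vector of Euclidean space. -/
def row {m n : ℕ} (A : Matrix (Fin m) (Fin n) ℝ) (i : Fin m) : EuclideanSpace ℝ (Fin n) :=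
  WithLp.toLp 2 (A i)

theorem row_mul {m n : ℕ} (D : Matrix (Fin m) (Fin m) ℝ) (A : Matrix (Fin m) (Fin n) ℝ) :
    row (D * A) = rowApply D (row A) := by
  ext i j
  simp [row, rowApply, Matrix.mul_apply]

theorem frobSq_eq_sum_norm_sq {m n : ℕ} (A : Matrix (Fin m) (Fin n) ℝ) :
    frobSq A = ∑ i, ‖row A i‖ ^ 2 := by
  simp only [frobSq, ← sum_sq_eq_norm_sq]
  rfl

/-- The rescaled sign matrix with columns `ω l`. -/
noncomputable def signCols {n r : ℕ} (ω : Fin r → Fin n → Bool) : Matrix (Fin n) (Fin r) ℝ :=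
  Matrix.of fun j l => if ω l j then 1 / √r else -(1 / √r)

theorem signCols_apply {n r : ℕ} (ω : Fin r → Fin n → Bool) (j : Fin n) (l : Fin r) :
    signCols ω j l = sgn (ω l j) / √r := by
  simp only [signCols, sgn, Matrix.of_apply]
  split_ifs <;> ring

theorem frobSq_mul_signCols {m n r : ℕ} (A : Matrix (Fin m) (Fin n) ℝ)
    (ω : Fin r → Fin n → Bool) :
    frobSq (A * signCols ω) = ∑ i, gram ω (row A i) (row A i) := by
  refine Finset.sum_congr rfl fun i _ => ?_
  rw [gram, Finset.sum_div]
  refine Finset.sum_congr rfl fun l _ => ?_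
  have : (A * signCols ω) i l = radSum (ω l) (row A i) / √r := by
    rw [Matrix.mul_apply, radSum, Finset.sum_div]
    refine Finset.sum_congr rfl fun j _ => ?_
    rw [signCols_apply, mul_div_assoc]
    rfl
  rw [this, div_pow, Real.sq_sqrt (Nat.cast_nonneg r), sq]

/-- The span of the optimal centers of a clustering. -/
def centerSpan {m n k : ℕ} (A : Matrix (Fin m) (Fin n) ℝ) (X : Matrix (Fin m) (Fin k) ℝ) :
    Submodule ℝ (EuclideanSpace ℝ (Fin n)) :=
  Submodule.span ℝ (Set.range (row (X.transpose * A)))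

theorem finrank_centerSpan_le {m n k : ℕ} (A : Matrix (Fin m) (Fin n) ℝ)
    (X : Matrix (Fin m) (Fin k) ℝ) : Module.finrank ℝ (centerSpan A X) ≤ k :=
  (finrank_range_le_card _).trans (by simp)

/-- Row p of XXᵀA lies in the span of the centers, and the orthogonal projection is the nearest
point of that span. -/
theorem sum_dist_centerSpan_le {m n k : ℕ} (A : Matrix (Fin m) (Fin n) ℝ)
    (X : Matrix (Fin m) (Fin k) ℝ) :
    ∑ p, ‖row A p - (centerSpan A X).starProjection (row A p)‖ ^ 2 ≤ cost A X := by
  rw [cost, frobSq_eq_sum_norm_sq]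
  refine Finset.sum_le_sum fun p _ => ?_
  have hmem : row (X * X.transpose * A) p ∈ centerSpan A X := by
    have : row (X * X.transpose * A) p = ∑ j, X p j • row (X.transpose * A) j := by
      ext q
      rw [Matrix.mul_assoc]
      simp [row, Matrix.mul_apply (M := X)]
    rw [this]
    exact Submodule.sum_mem _ fun j _ =>
      Submodule.smul_mem _ _ (Submodule.subset_span ⟨j, rfl⟩)
  have hrow : row (A - X * X.transpose * A) p = row A p - row (X * X.transpose * A) p := by
    ext q
    simp [row]
  rw [hrow]
  gcongr
  rw [Submodule.starProjection_minimal]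
  exact ciInf_le ⟨0, by rintro _ ⟨x, rfl⟩; exact norm_nonneg _⟩
    (⟨_, hmem⟩ : centerSpan A X)

/-- The deterministic core: the three events concern `X₀` only, while `X` is arbitrary. The net
accuracy is ε/32 because the passage from norms to the bilinear form loses a factor 4, which leaves
ε/8. -/
theorem residual_cost_le {m n r k : ℕ} (hk : 1 ≤ k) (hkm : k ≤ m) (A : Matrix (Fin m) (Fin n) ℝ)
    {X₀ : Matrix (Fin m) (Fin k) ℝ} (hX₀ : IsIndicator X₀) (ω : Fin r → Fin n → Bool) {ε : ℝ}
    (hε : 0 < ε) (hε' : ε < 1 / 3)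
    (h1 : ∀ z ∈ centerSpan A X₀, (1 - 4 * (ε / 32)) * ‖z‖ ^ 2 ≤ gram ω z z)
    (h2 : ∑ i, gram ω (row (residual X₀ * A) i) (row (residual X₀ * A) i) ≤
      (1 + ε / 8) * ∑ i, ‖row (residual X₀ * A) i‖ ^ 2)
    (h3 : ∑ p, ∑ v, gram ω (stdOrthonormalBasis ℝ (centerSpan A X₀) v)
        (row A p - (centerSpan A X₀).starProjection (row A p)) ^ 2 ≤
      (ε / 8) ^ 2 * ∑ p, ‖row A p - (centerSpan A X₀).starProjection (row A p)‖ ^ 2)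
    {γ : ℝ} (hγ : 1 ≤ γ) {X : Matrix (Fin m) (Fin k) ℝ} (hX : IsIndicator X)
    (hcost : cost (A * signCols ω) X ≤ γ * optCost (A * signCols ω) k) :
    cost A X ≤ (1 + (1 + ε) * γ) * cost A X₀ := by
  set F := cost A X₀ with hF
  have hF0 : 0 ≤ F := by
    rw [hF, cost]
    exact Finset.sum_nonneg fun _ _ => Finset.sum_nonneg fun _ _ => sq_nonneg _
  obtain ⟨α, hα, ha, hb⟩ := sum_norm_sq_le_of_gram ω (centerSpan A X₀) (residual_transpose X)
    (residual_mul_residual hX.transpose_mul_self) (row A) (ε := ε / 8) (F := F) (by positivity)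
    (fun z hz => by convert h1 z hz using 2; ring) (sum_dist_centerSpan_le A X₀) h3
  have hT : ∑ i, gram ω (rowApply (residual X) (row A) i) (rowApply (residual X) (row A) i)
      = cost (A * signCols ω) X := by
    rw [cost_eq_frobSq, ← Matrix.mul_assoc, frobSq_mul_signCols, row_mul]
  have hF2 : cost (A * signCols ω) X₀ ≤ (1 + ε / 8) * F := by
    rw [cost_eq_frobSq, ← Matrix.mul_assoc, frobSq_mul_signCols, hF, cost_eq_frobSq,
      frobSq_eq_sum_norm_sq]
    exact h2
  have hopt : optCost (A * signCols ω) k ≤ cost (A * signCols ω) X₀ :=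
    (optCost_isLeast hk hkm _).2 ⟨X₀, hX₀, rfl⟩
  rw [hT] at hb
  rw [cost_eq_frobSq, frobSq_eq_sum_norm_sq, row_mul]
  refine ha.trans ?_
  have h4 : (1 - 2 * (ε / 8)) * α ≤ γ * ((1 + ε / 8) * F) + ε / 8 * F := by
    refine hb.trans (add_le_add_left (hcost.trans ?_) _)
    exact mul_le_mul_of_nonneg_left (hopt.trans hF2) (by linarith)
  have h5 : 0 ≤ γ * F := by positivity
  have h6 : ε / 8 * F ≤ ε / 8 * (γ * F) :=
    mul_le_mul_of_nonneg_left (by nlinarith) (by positivity)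
  -- The slack is (1 - ε/4)(1 + ε) - (1 + ε/4) = ε(2 - ε)/4 ≥ 0.
  have h7 : (1 - 2 * (ε / 8)) * α ≤ (1 - 2 * (ε / 8)) * ((1 + ε) * γ * F) := by
    refine h4.trans ?_
    have : (1 - 2 * (ε / 8)) * ((1 + ε) * γ * F) - (1 + ε / 4) * (γ * F)
        = ε * (2 - ε) / 4 * (γ * F) := by ring
    have h8 : 0 ≤ ε * (2 - ε) / 4 * (γ * F) :=
      mul_nonneg (div_nonneg (mul_nonneg hε.le (by linarith)) (by norm_num)) h5
    linarith
  have h8 : α ≤ (1 + ε) * γ * F := le_of_mul_le_mul_left h7 (by linarith)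
  linarith

/-- As 8 · 32² = 8192, the exponent is at most -ck/8192, so each of the k dimensions gains a factor
10⁻⁴ against the 25 of the net. Since 25 · 10⁻⁴ ≤ 1, the case k = 1 is the worst, with 4 · 25 · 10⁻⁴
= 0.01. -/
theorem numeric_net_bound {c k r : ℝ} (k' : ℕ) (hk' : (k' : ℝ) = k) (hk : 1 ≤ k') {ε : ℝ}
    (hc : 100000000 ≤ c) (hr : c * k ≤ r * ε ^ 2) :
    4 * 25 ^ k' * Real.exp (-(r * (ε / 32) ^ 2 / 8)) ≤ 0.01 := by
  have hE : 10000 ≤ Real.exp (c / 8192) := by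
    have := Real.add_one_le_exp (c / 8192)
    linarith
  have h1 : Real.exp (-(r * (ε / 32) ^ 2 / 8)) ≤ (Real.exp (c / 8192))⁻¹ ^ k' := by
    rw [← Real.exp_neg, ← Real.exp_nat_mul, Real.exp_le_exp, hk']
    nlinarith
  calc 4 * 25 ^ k' * Real.exp (-(r * (ε / 32) ^ 2 / 8))
      ≤ 4 * 25 ^ k' * (Real.exp (c / 8192))⁻¹ ^ k' := by gcongr
    _ = 4 * (25 * (Real.exp (c / 8192))⁻¹) ^ k' := by rw [mul_pow, mul_assoc]
    _ ≤ 4 * (25 * (10000 : ℝ)⁻¹) ^ k' := by gcongr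
    _ ≤ 4 * (25 * (10000 : ℝ)⁻¹) := by
        gcongr
        exact pow_le_of_le_one (by norm_num) (by norm_num) (by omega)
    _ ≤ 0.01 := by norm_num

/-- With probability at least `0.96` over the sign matrix, every `γ`-approximate clustering of the
projected points is a good clustering of the original points. -/
theorem prob_good_projection {c : ℕ} (hc : 100000000 ≤ c) {m n k r : ℕ} (hk : 1 ≤ k) (hkm : k ≤ m)
    {ε : ℝ} (hε : 0 < ε) (hε' : ε < 1 / 3) (hr : (c : ℝ) * k / ε ^ 2 ≤ r)
    (A : Matrix (Fin m) (Fin n) ℝ) :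
    0.96 ≤ prob (fun ω : Fin r → Fin n → Bool => ∀ γ : ℝ, 1 ≤ γ →
      ∀ X : Matrix (Fin m) (Fin k) ℝ, IsIndicator X →
        cost (A * signCols ω) X ≤ γ * optCost (A * signCols ω) k →
        cost A X ≤ (1 + (1 + ε) * γ) * optCost A k) := by
  obtain ⟨X₀, hX₀, hopt⟩ := (optCost_isLeast hk hkm A).1
  have hk1 : (1 : ℝ) ≤ k := by exact_mod_cast hk
  have hc1 : (100000000 : ℝ) ≤ c := by exact_mod_cast hc
  have hr1 : (c : ℝ) * k ≤ r * ε ^ 2 := (div_le_iff₀ (by positivity)).1 hr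
  have hr0 : 0 < r := by
    rcases Nat.eq_zero_or_pos r with h | h
    · subst h
      have : (0 : ℝ) < c * k := by positivity
      simp at hr1
      linarith
    · exact h
  have hr0' : (0 : ℝ) < r := by exact_mod_cast hr0
  set U := centerSpan A X₀
  have hU : Module.finrank ℝ U ≤ k := finrank_centerSpan_le A X₀
  have p1 := prob_not_isometry_le (n := n) hr0 U (ε := ε / 32) (by positivity) (by linarith)
  have p2 := prob_not_sum_gram_le hr0 (row (residual X₀ * A)) (ε := ε / 8) (by positivity)
  have p3 := prob_not_sum_cross_le hr0 U (fun p => row A p - U.starProjection (row A p))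
    (fun p => U.sub_starProjection_mem_orthogonal _) (ε := ε / 8) (by positivity)
  have b1 : 4 * 25 ^ Module.finrank ℝ U * Real.exp (-(r * (ε / 32) ^ 2 / 8)) ≤ 0.01 := by
    refine le_trans ?_ (numeric_net_bound k rfl hk hc1 hr1)
    gcongr
    norm_num
  have hck : (100000000 : ℝ) ≤ r * ε ^ 2 := by nlinarith
  have b2 : √(3 / r) / (ε / 8) ≤ 0.01 := by
    rw [div_le_iff₀ (by positivity)]
    refine Real.sqrt_le_iff.2 ⟨by positivity, ?_⟩
    rw [div_le_iff₀ hr0']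
    nlinarith
  have b3 : 3 * Module.finrank ℝ U / (r * (ε / 8) ^ 2) ≤ (0.01 : ℝ) := by
    rw [div_le_iff₀ (by positivity)]
    have : (Module.finrank ℝ U : ℝ) ≤ k := by exact_mod_cast hU
    nlinarith
  set e1 : (Fin r → Fin n → Bool) → Prop := fun ω =>
    ∀ z ∈ U, (1 - 4 * (ε / 32)) * ‖z‖ ^ 2 ≤ gram ω z z with he1
  set e2 : (Fin r → Fin n → Bool) → Prop := fun ω =>
    ∑ i, gram ω (row (residual X₀ * A) i) (row (residual X₀ * A) i) ≤
      (1 + ε / 8) * ∑ i, ‖row (residual X₀ * A) i‖ ^ 2 with he2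
  set e3 : (Fin r → Fin n → Bool) → Prop := fun ω =>
    ∑ p, ∑ v, gram ω (stdOrthonormalBasis ℝ U v) (row A p - U.starProjection (row A p)) ^ 2 ≤
      (ε / 8) ^ 2 * ∑ p, ‖row A p - U.starProjection (row A p)‖ ^ 2 with he3
  -- Each of the three events fails with probability at most 0.01.
  have hbad : prob (fun ω => ¬ (e1 ω ∧ e2 ω ∧ e3 ω)) ≤ 0.04 := by
    have h := (prob_mono (p := fun ω => ¬ (e1 ω ∧ e2 ω ∧ e3 ω))
      (q := fun ω => ¬ e1 ω ∨ (¬ e2 ω ∨ ¬ e3 ω)) (fun ω hω => by tauto)).trans (prob_or_le _ _)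
    have h' := prob_or_le (fun ω => ¬ e2 ω) (fun ω => ¬ e3 ω)
    linarith [p1.trans b1, p2.trans b2, p3.trans b3]
  rw [prob_not] at hbad
  have : 0.96 ≤ prob (fun ω => e1 ω ∧ e2 ω ∧ e3 ω) := by linarith
  refine this.trans (prob_mono ?_)
  rintro ω ⟨h1, h2, h3⟩ γ hγ X hX hcost
  rw [hopt]
  exact residual_cost_le hk hkm A hX₀ ω hε hε' h1 h2 h3 hγ hX hcost

theorem toOuterMeasure_le_one {α : Type*} (p : PMF α) (s : Set α) : p.toOuterMeasure s ≤ 1 := by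
  rw [PMF.toOuterMeasure_apply, ← p.tsum_coe]
  exact ENNReal.tsum_le_tsum fun x => Set.indicator_le_self s _ x

theorem features_eq_map_signCols {m n : ℕ} (A : Matrix (Fin m) (Fin n) ℝ) (r : ℕ) :
    features A r = (PMF.uniformOfFintype (Fin n → Fin r → Bool)).map
      (fun S => A * signCols fun l j => S j l) := by
  rw [features, signMatrix, PMF.map_comp]
  rfl

/-- Conditioned on a good sign matrix, the independent randomness of the algorithm succeeds with
probability at least 1 - δ, and 0.96(1 - δ) ≥ 0.96 - δ for δ ≥ 0. -/
theorem ofReal_le_features_bind {c : ℕ} (hc : 100000000 ≤ c) {m n k r : ℕ} (hk : 1 ≤ k)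
    (hkm : k ≤ m) {ε : ℝ} (hε : 0 < ε) (hε' : ε < 1 / 3) (hr : (c : ℝ) * k / ε ^ 2 ≤ r)
    (A : Matrix (Fin m) (Fin n) ℝ) {γ δ : ℝ}
    (alg : Matrix (Fin m) (Fin r) ℝ → PMF (Matrix (Fin m) (Fin k) ℝ))
    (halg : IsApproximation γ δ alg) :
    ENNReal.ofReal (0.96 - δ) ≤ ((features A r).bind alg).toOuterMeasure
      {X | IsIndicator X ∧ cost A X ≤ (1 + (1 + ε) * γ) * optCost A k} := by
  classical
  obtain ⟨hγ, halg⟩ := halg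
  set T := {X | IsIndicator X ∧ cost A X ≤ (1 + (1 + ε) * γ) * optCost A k} with hT
  -- A negative δ would demand a probability above 1.
  have hδ : 0 ≤ δ := by
    have h := (halg 0).2.trans (toOuterMeasure_le_one _ _)
    by_contra! h0
    rw [ENNReal.ofReal_le_one] at h
    linarith
  set good : (Fin r → Fin n → Bool) → Prop := fun ω => ∀ γ : ℝ, 1 ≤ γ →
      ∀ X : Matrix (Fin m) (Fin k) ℝ, IsIndicator X →
        cost (A * signCols ω) X ≤ γ * optCost (A * signCols ω) k →
        cost A X ≤ (1 + (1 + ε) * γ) * optCost A k with hgood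
  have hprob := prob_good_projection hc hk hkm hε hε' hr A
  rw [← hgood] at hprob
  have hgoodT : ∀ ω, good ω →
      ENNReal.ofReal (1 - δ) ≤ (alg (A * signCols ω)).toOuterMeasure T := by
    intro ω hω
    obtain ⟨hsupp, hle⟩ := halg (A * signCols ω)
    refine hle.trans ?_
    refine PMF.toOuterMeasure_mono _ ?_
    rintro X ⟨hX, hXs⟩
    exact ⟨hsupp X hXs, hω γ hγ X (hsupp X hXs) hX⟩
  rw [features_eq_map_signCols, PMF.bind_map, PMF.toOuterMeasure_bind_apply, tsum_fintype]
  set N : ℕ := Fintype.card (Fin n → Fin r → Bool) with hN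
  have hN0 : (0 : ℝ) < N := by exact_mod_cast Fintype.card_pos
  have hterm : ∀ S : Fin n → Fin r → Bool,
      ENNReal.ofReal ((if good (fun l j => S j l) then 1 / (N : ℝ) else 0) * (1 - δ)) ≤
        PMF.uniformOfFintype (Fin n → Fin r → Bool) S *
          ((alg ∘ fun S : Fin n → Fin r → Bool => A * signCols fun l j => S j l) S).toOuterMeasure
            T := by
    intro S
    split_ifs with h
    · rw [ENNReal.ofReal_mul (by positivity), PMF.uniformOfFintype_apply, ← hN]
      refine mul_le_mul' (le_of_eq ?_) (hgoodT _ h)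
      rw [one_div, ENNReal.ofReal_inv_of_pos hN0, ENNReal.ofReal_natCast]
    · simp
  -- The law of R indexes signs by row and then column, `prob` by column and then row; the
  -- transposition is a bijection.
  have hsum : ∑ S : Fin n → Fin r → Bool,
      (if good (fun l j => S j l) then 1 / (N : ℝ) else 0) = prob good := by
    rw [prob, Fintype.expect_eq_sum_div_card, Finset.sum_div,
      ← (Equiv.piComm fun (_ : Fin r) (_ : Fin n) => Bool).symm.sum_comp]
    refine Finset.sum_congr rfl fun S _ => ?_
    have hcard : Fintype.card (Fin r → Fin n → Bool) = N :=
      Fintype.card_congr (Equiv.piComm fun (_ : Fin r) (_ : Fin n) => Bool)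
    rw [hcard, ite_div, zero_div]
    rfl
  rcases le_total δ 1 with h1 | h1
  · calc ENNReal.ofReal (0.96 - δ)
        ≤ ENNReal.ofReal (∑ S : Fin n → Fin r → Bool,
            (if good (fun l j => S j l) then 1 / (N : ℝ) else 0) * (1 - δ)) := by
          refine ENNReal.ofReal_le_ofReal ?_
          rw [← Finset.sum_mul, hsum]
          nlinarith
      _ = ∑ S : Fin n → Fin r → Bool, ENNReal.ofReal
            ((if good (fun l j => S j l) then 1 / (N : ℝ) else 0) * (1 - δ)) := by
          refine ENNReal.ofReal_sum_of_nonneg fun S _ => mul_nonneg ?_ (by linarith)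
          split_ifs <;> positivity
      _ ≤ _ := Finset.sum_le_sum fun S _ => hterm S
  · rw [ENNReal.ofReal_of_nonpos (by linarith)]
    exact zero_le

end KMeans

namespace RealRAM

/-! ### Program logic -/

/-- Started on the store `s`, the program `p` ends in the store `s'` after at most `t` steps. -/
def Exec (W : ℕ) (p : Program) (s : Store) (t : ℕ) (s' : Store) : Prop :=
  ∃ t' ≤ t, ∀ K T, run W (t' + T) (some (p :: K, s)) = run W T (some (K, s'))

variable {W : ℕ}

theorem run_succ_of_step_eq {c c' : Option Config} (h : step W c = PMF.pure c') (T : ℕ) :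
    run W (1 + T) c = run W T c' := by
  rw [add_comm, run, h, PMF.pure_bind]

theorem Exec.mono {p : Program} {s s' : Store} {t t' : ℕ} (h : Exec W p s t s') (htt : t ≤ t') :
    Exec W p s t' s' := by
  obtain ⟨u, hu, h⟩ := h
  exact ⟨u, hu.trans htt, h⟩

theorem Exec.seq {p q : Program} {s s₁ s₂ : Store} {t₁ t₂ : ℕ} (hp : Exec W p s t₁ s₁)
    (hq : Exec W q s₁ t₂ s₂) : Exec W (.seq p q) s (t₁ + t₂ + 1) s₂ := by
  obtain ⟨u, hu, hp⟩ := hp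
  obtain ⟨v, hv, hq⟩ := hq
  refine ⟨1 + (u + v), by omega, fun K T => ?_⟩
  rw [add_assoc, run_succ_of_step_eq (c' := some (p :: q :: K, s)) rfl, add_assoc, hp, hq]

theorem run_while_true {b : Test} {p : Program} {s : Store} (hb : b.holds s) (K : List Program)
    (T : ℕ) : run W (1 + T) (some (.while b p :: K, s)) = run W T (some (p :: .while b p :: K, s)) :=
  run_succ_of_step_eq (by simp [step, hb]) T

theorem run_while_false {b : Test} {p : Program} {s : Store} (hb : ¬ b.holds s) (K : List Program)
    (T : ℕ) : run W (1 + T) (some (.while b p :: K, s)) = run W T (some (K, s)) :=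
  run_succ_of_step_eq (by simp [step, hb]) T

/-- The time of a round may depend on its index, as the folding loop needs: its rounds shrink
geometrically. -/
theorem exec_while {b : Test} {p : Program} {t : ℕ → ℕ} {N : ℕ} (I : ℕ → Store → Prop)
    (htest : ∀ j s, I j s → (b.holds s ↔ j < N))
    (hbody : ∀ j s, j < N → I j s → ∃ s', Exec W p s (t j) s' ∧ I (j + 1) s')
    {s : Store} (hs : I 0 s) :
    ∃ s', Exec W (.while b p) s (∑ j ∈ Finset.range N, (t j + 1) + 1) s' ∧ I N s' := by
  have key : ∀ d j s, j + d = N → I j s →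
      ∃ s', Exec W (.while b p) s (∑ i ∈ Finset.range d, (t (j + i) + 1) + 1) s' ∧ I N s' := by
    intro d
    induction d with
    | zero =>
      intro j s hj hI
      have hj' : j = N := by omega
      subst hj'
      refine ⟨s, ⟨1, by omega, fun K T => ?_⟩, hI⟩
      exact run_while_false (by simp [htest j s hI]) K T
    | succ d ih =>
      intro j s hj hI
      obtain ⟨s₁, ⟨u, hu, h₁⟩, hI₁⟩ := hbody j s (by omega) hI
      obtain ⟨s₂, ⟨v, hv, h₂⟩, hI₂⟩ := ih (j + 1) s₁ (by omega) hI₁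
      refine ⟨s₂, ⟨1 + (u + v), ?_, fun K T => ?_⟩, hI₂⟩
      · rw [Finset.sum_range_succ']
        simp only [add_zero, add_assoc, add_comm 1] at hv ⊢
        omega
      · rw [add_assoc, run_while_true ((htest j s hI).2 (by omega)), add_assoc, h₁, h₂]
  have h := key N 0 s (by omega) hs
  simpa only [zero_add] using h

theorem exec_for {x y : ℕ} {p : Program} {t N : ℕ} (I : ℕ → Store → Prop)
    (hreg : ∀ j s, I j s → s.ireg x = j ∧ s.ireg y = N)
    (hbody : ∀ j s, j < N → I j s → ∃ s', Exec W p s t s' ∧ I (j + 1) s')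
    {s : Store} (hs : I 0 s) :
    ∃ s', Exec W (.while (.intLt x y) p) s (N * (t + 1) + 1) s' ∧ I N s' := by
  have h := exec_while (t := fun _ => t) I (b := .intLt x y)
    (fun j s hI => by simp only [Test.holds, hreg j s hI]) hbody hs
  simpa using h

/-! ### Straight-line code -/

/-- A sequence of instructions. -/
def code : Instr → List Instr → Program
  | i, [] => .instr i
  | i, j :: l => .seq (.instr i) (code j l)

/-- The weakest precondition of a deterministic instruction for a postcondition. -/
def Instr.wp (W : ℕ) (Q : Store → Prop) : Instr → Store → Prop
  | .intConst x c, s => c ≤ W ∧ Q { s with ireg := Function.update s.ireg x c }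
  | .intOp o x y z, s => o.eval (s.ireg y) (s.ireg z) ≤ W ∧
      Q { s with ireg := Function.update s.ireg x (o.eval (s.ireg y) (s.ireg z)) }
  | .intLoad x a y, s => s.imem a (s.ireg y) ≤ W ∧
      Q { s with ireg := Function.update s.ireg x (s.imem a (s.ireg y)) }
  | .intStore a y x, s => Q { s with
      imem := Function.update s.imem a (Function.update (s.imem a) (s.ireg y) (s.ireg x)) }
  | .rand _ _, _ => False
  | .ofInt u x, s => Q (s.setReal u (s.ireg x : ℝ))
  | .realOp o u v w, s => Q (s.setReal u (o.eval (s.rreg v) (s.rreg w)))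
  | .sqrt u v, s => Q (s.setReal u (Real.sqrt (s.rreg v)))
  | .realLoad u a y, s => Q (s.setReal u (s.rmem a (s.ireg y)))
  | .realStore a y u, s => Q { s with
      rmem := Function.update s.rmem a (Function.update (s.rmem a) (s.ireg y) (s.rreg u)) }

/-- The weakest precondition of a list of deterministic instructions. -/
def codeWp (W : ℕ) (Q : Store → Prop) : List Instr → Store → Prop
  | [], s => Q s
  | i :: l, s => i.wp W (codeWp W Q l) s

theorem Instr.exec_of_wp {Q : Store → Prop} {i : Instr} {s : Store} (h : i.wp W Q s) :
    ∃ s', i.exec W s = PMF.pure (some s') ∧ Q s' := by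
  cases i with
  | intConst x c => exact ⟨_, by simp [Instr.exec, Store.setInt, h.1], h.2⟩
  | intOp o x y z => exact ⟨_, by simp [Instr.exec, Store.setInt, h.1], h.2⟩
  | intLoad x a y => exact ⟨_, by simp [Instr.exec, Store.setInt, h.1], h.2⟩
  | rand x y => exact h.elim
  | _ => exact ⟨_, rfl, h⟩

theorem exists_run_instr {Q : Store → Prop} {i : Instr} {s : Store} (h : i.wp W Q s) :
    ∃ s', (∀ K T, run W (1 + T) (some (.instr i :: K, s)) = run W T (some (K, s'))) ∧ Q s' := by
  obtain ⟨s', h₁, h₂⟩ := Instr.exec_of_wp h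
  refine ⟨s', fun K T => run_succ_of_step_eq ?_ T, h₂⟩
  rw [step, h₁, PMF.pure_map]
  rfl

/-- The number of steps is exact: one for each instruction and one for each sequencing. The drawing
loop relies on this, since all random branches must stay synchronized. -/
theorem exists_run_code {Q : Store → Prop} {i : Instr} {l : List Instr} {s : Store}
    (h : codeWp W Q (i :: l) s) :
    ∃ s', (∀ K T, run W (2 * l.length + 1 + T) (some (code i l :: K, s)) =
      run W T (some (K, s'))) ∧ Q s' := by
  induction l generalizing i s with
  | nil => exact exists_run_instr h
  | cons j l ih =>
    obtain ⟨s₁, h₁, hw⟩ := exists_run_instr (Q := codeWp W Q (j :: l)) h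
    obtain ⟨s₂, h₂, hQ⟩ := ih hw
    refine ⟨s₂, fun K T => ?_, hQ⟩
    rw [List.length_cons, show 2 * (l.length + 1) + 1 + T = 1 + (1 + (2 * l.length + 1 + T)) by ring,
      ← h₂, ← h₁]
    exact run_succ_of_step_eq rfl _

theorem exec_instr {Q : Store → Prop} {i : Instr} {s : Store} (h : i.wp W Q s) :
    ∃ s', Exec W (.instr i) s 1 s' ∧ Q s' := by
  obtain ⟨s', h₁, h₂⟩ := exists_run_instr h
  exact ⟨s', ⟨1, le_rfl, h₁⟩, h₂⟩

theorem exec_code {Q : Store → Prop} {i : Instr} {l : List Instr} {s : Store}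
    (h : codeWp W Q (i :: l) s) : ∃ s', Exec W (code i l) s (2 * l.length + 1) s' ∧ Q s' := by
  obtain ⟨s', h₁, h₂⟩ := exists_run_code h
  exact ⟨s', ⟨_, le_rfl, h₁⟩, h₂⟩

/-- A halted machine idles, so an upper bound on the running time determines the configuration at
any later time. -/
theorem run_halted (s : Store) (T : ℕ) :
    run W T (some ([], s)) = PMF.pure (some ([], s)) := by
  induction T with
  | zero => rfl
  | succ T ih => rw [run, step, PMF.pure_bind, ih]

theorem Exec.run_eq {p : Program} {s s' : Store} {t T : ℕ} (h : Exec W p s t s') (hT : t ≤ T) :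
    run W T (some ([p], s)) = PMF.pure (some ([], s')) := by
  obtain ⟨t', ht, h⟩ := h
  obtain ⟨d, rfl⟩ := Nat.exists_eq_add_of_le (ht.trans hT)
  rw [h, run_halted]

end RealRAM

namespace RealRAM

open Rademacher (sgn)

/-! ### The mailman algorithm -/

namespace Mailman

/-- The sum of the entries of `x` whose words agree with `q` in the lowest `l` bits. -/
noncomputable def bucket (N l : ℕ) (v : ℕ → ℕ) (x : ℕ → ℝ) (q : ℕ) : ℝ :=
  ∑ e ∈ Finset.range N, if v e % 2 ^ l = q then x e else 0

theorem mod_two_pow_succ (x l : ℕ) :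
    x % 2 ^ (l + 1) = x % 2 ^ l + if x.testBit l then 2 ^ l else 0 := by
  rw [Nat.mod_pow_succ, Nat.testBit_eq_decide_div_mod_eq]
  rcases Nat.mod_two_eq_zero_or_one (x / 2 ^ l) with h | h <;> simp [h]

/-- Adding the buckets whose labels differ in bit l forgets that bit. -/
theorem bucket_add {N l : ℕ} (v : ℕ → ℕ) (x : ℕ → ℝ) {q : ℕ} (hq : q < 2 ^ l) :
    bucket N (l + 1) v x q + bucket N (l + 1) v x (q + 2 ^ l) = bucket N l v x q := by
  rw [bucket, bucket, bucket, ← Finset.sum_add_distrib]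
  refine Finset.sum_congr rfl fun e _ => ?_
  have hlt : v e % 2 ^ l < 2 ^ l := Nat.mod_lt _ (by positivity)
  rw [mod_two_pow_succ]
  cases (v e).testBit l
  · have : v e % 2 ^ l ≠ q + 2 ^ l := by omega
    simp [this]
  · have : v e % 2 ^ l + 2 ^ l ≠ q := by omega
    simp [this]

/-- Each entry lies in exactly one bucket, in the upper half if bit l of its word is set and in the
lower half otherwise, so it is counted once, with the sign of that bit. -/
theorem sum_bucket_sub {N l : ℕ} (v : ℕ → ℕ) (x : ℕ → ℝ) :
    ∑ q ∈ Finset.range (2 ^ l), (bucket N (l + 1) v x (q + 2 ^ l) - bucket N (l + 1) v x q) =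
      ∑ e ∈ Finset.range N, x e * sgn ((v e).testBit l) := by
  simp only [bucket, ← Finset.sum_sub_distrib]
  rw [Finset.sum_comm]
  refine Finset.sum_congr rfl fun e _ => ?_
  have hlt : v e % 2 ^ l < 2 ^ l := Nat.mod_lt _ (by positivity)
  rw [Finset.sum_eq_single_of_mem (v e % 2 ^ l) (Finset.mem_range.2 hlt)]
  · rw [mod_two_pow_succ]
    cases (v e).testBit l
    · simp
    · simp
  · intro q hq hne
    have hq' := Finset.mem_range.1 hq
    rw [mod_two_pow_succ]
    cases (v e).testBit l
    · have h1 : v e % 2 ^ l ≠ q + 2 ^ l := by omega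
      simp [h1, hne.symm]
    · have h1 : v e % 2 ^ l + 2 ^ l ≠ q := by omega
      have h2 : v e % 2 ^ l ≠ q := hne.symm
      simp [h1, h2]

/-- The entry `(i, j)` of the product of the `· × n` matrix stored in `a` with the rescaled sign
matrix encoded by the words `w`: each word holds `L` consecutive signs of a row. -/
noncomputable def entry (n r L : ℕ) (w : ℕ → ℕ) (a : ℕ → ℝ) (i j : ℕ) : ℝ :=
  (∑ e ∈ Finset.range n, a (i * n + e) * sgn ((w (j / L * n + e)).testBit (L - 1 - j % L))) / √r

/-- The first `c` entries of row `i`, and all earlier rows, have been written. -/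
def Written (n r L : ℕ) (w : ℕ → ℕ) (a : ℕ → ℝ) (i c : ℕ) (out : ℕ → ℝ) : Prop :=
  (∀ i' < i, ∀ j < r, out (i' * r + j) = entry n r L w a i' j) ∧
    ∀ j < c, out (i * r + j) = entry n r L w a i j

theorem Written.update {n r L : ℕ} {w : ℕ → ℕ} {a : ℕ → ℝ} {i c : ℕ} {out : ℕ → ℝ}
    (h : Written n r L w a i c out) :
    Written n r L w a i (c + 1) (Function.update out (i * r + c) (entry n r L w a i c)) := by
  refine ⟨fun i' hi' j hj => ?_, fun j hj => ?_⟩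
  · have h1 : (i' + 1) * r ≤ i * r := Nat.mul_le_mul_right r hi'
    rw [Nat.add_mul, one_mul] at h1
    rw [Function.update_of_ne (by omega), h.1 i' hi' j hj]
  · rcases Nat.lt_succ_iff_lt_or_eq.1 hj with hj | rfl
    · rw [Function.update_of_ne (by omega), h.2 j hj]
    · rw [Function.update_self]

/-- The last block of a row may run past column r. The excess lands in cells of later rows, which
are rewritten in their turn, or beyond the matrix; so only the entries before column r are kept, and
the count restarts at 0. -/
theorem Written.next_row {n r L : ℕ} {w : ℕ → ℕ} {a : ℕ → ℝ} {i c : ℕ} {out : ℕ → ℝ}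
    (h : Written n r L w a i c out) (hc : r ≤ c) : Written n r L w a (i + 1) 0 out := by
  refine ⟨fun i' hi' j hj => ?_, fun j hj => absurd hj (Nat.not_lt_zero j)⟩
  rcases Nat.lt_succ_iff_lt_or_eq.1 hi' with hi' | rfl
  · exact h.1 i' hi' j hj
  · exact h.2 j (hj.trans_le hc)

/-- The word bound `W` suffices for the dimensions of the problem. -/
structure Fits (W m n r L B : ℕ) : Prop where
  two_le : 2 ≤ W
  pow_le : 2 ^ L ≤ n
  le_n : n ≤ W
  le_mn : m * n ≤ W
  le_nB : B * n ≤ W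
  le_out : m * r + B * L ≤ W
  le_m : m ≤ W
  le_B : B ≤ W

/-- The register contents during the processing of row `i` and block `b`, when `c` entries of the
row have been written. -/
structure Inv (m n r L B : ℕ) (w : ℕ → ℕ) (a : ℕ → ℝ) (i b c : ℕ) (s : Store) : Prop where
  h0 : s.ireg 0 = m
  h1 : s.ireg 1 = n
  h3 : s.ireg 3 = r
  h4 : s.ireg 4 = 1
  h5 : s.ireg 5 = 2 ^ L
  h7 : s.ireg 7 = B
  h9 : s.ireg 9 = 0
  h10 : s.ireg 10 = i
  h11 : s.ireg 11 = b
  h15 : s.ireg 15 = i * r + c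
  h16 : s.ireg 16 = i * n
  h17 : s.ireg 17 = b * n
  hsqrt : s.rreg 5 = √r
  hzero : s.rreg 6 = 0
  himem : s.imem 0 = w
  hrmem : s.rmem 0 = a
  hout : Written n r L w a i c (s.rmem 1)

/-- Clear the first `2 ^ L` buckets. -/
def clearLoop : Program :=
  .while (.intLt 12 5) (code (.realStore 2 12 6) [.intOp .add 12 12 4])

/-- Add each entry of the row to the bucket of its word. -/
def fillLoop : Program :=
  .while (.intLt 12 1) (code (.intOp .add 14 17 12) [.intLoad 14 0 14, .realLoad 1 2 14,
    .intOp .add 18 16 12, .realLoad 2 0 18, .realOp .add 1 1 2, .realStore 2 14 1,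
    .intOp .add 12 12 4])

/-- Merge the upper half of the buckets into the lower half and sum up the differences. -/
def mergeLoop : Program :=
  .while (.intLt 12 13) (code (.realLoad 1 2 12) [.intOp .add 14 12 13, .realLoad 2 2 14,
    .realOp .sub 4 2 1, .realOp .add 3 3 4, .realOp .add 1 1 2, .realStore 2 12 1,
    .intOp .add 12 12 4])

/-- Extract the signed sums for the bits of the words, from the highest to the lowest. -/
def foldLoop : Program :=
  .while (.intLt 4 13) (.seq (code (.intConst 14 2) [.intOp .div 13 13 14, .realOp .add 3 6 6,
    .intConst 12 0]) (.seq mergeLoop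
      (code (.realOp .div 3 3 5) [.realStore 1 15 3, .intOp .add 15 15 4])))

/-- Process the blocks of a row. -/
def blockLoop : Program :=
  .while (.intLt 11 7) (.seq (.instr (.intConst 12 0)) (.seq clearLoop
    (.seq (.instr (.intConst 12 0)) (.seq fillLoop (.seq (.instr (.intOp .add 13 5 9))
      (.seq foldLoop (code (.intOp .add 17 17 1) [.intOp .add 11 11 4])))))))

/-- Process the rows. -/
def rowLoop : Program :=
  .while (.intLt 10 0) (.seq (code (.intOp .mul 16 10 1) [.intOp .mul 15 10 3, .intConst 17 0,
    .intConst 11 0]) (.seq blockLoop (.instr (.intOp .add 10 10 4))))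

variable {W m n r L B : ℕ} {w : ℕ → ℕ} {a : ℕ → ℝ} {i b c : ℕ}

theorem exec_clearLoop (hW : Fits W m n r L B) {s : Store} (hs : Inv m n r L B w a i b c s)
    (h12 : s.ireg 12 = 0) :
    ∃ s', Exec W clearLoop s (2 ^ L * 4 + 1) s' ∧
      (Inv m n r L B w a i b c s' ∧ s'.ireg 12 = 2 ^ L ∧ ∀ q < 2 ^ L, s'.rmem 2 q = 0) := by
  refine exec_for (fun j s => Inv m n r L B w a i b c s ∧ s.ireg 12 = j ∧ ∀ q < j, s.rmem 2 q = 0)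
    (fun j s hI => ⟨hI.2.1, hI.1.h5⟩) ?_ ⟨hs, h12, by simp⟩
  rintro j s hj ⟨⟨⟩, h12, hz⟩
  refine exec_code ?_
  have := hW.le_n
  have := hW.pow_le
  simp [codeWp, Instr.wp, IntOp.eval, Function.update_apply, *]
  refine ⟨by omega, ⟨?_, ?_⟩⟩
  · constructor <;> simp [*]
  · intro q hq hne
    exact hz q (by omega)

theorem exec_fillLoop (hW : Fits W m n r L B) (hi : i < m) (hb : b < B)
    (hw : ∀ q < B * n, w q < 2 ^ L) {s : Store} (hs : Inv m n r L B w a i b c s)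
    (h12 : s.ireg 12 = 0) (hz : ∀ q < 2 ^ L, s.rmem 2 q = 0) :
    ∃ s', Exec W fillLoop s (n * 16 + 1) s' ∧ (Inv m n r L B w a i b c s' ∧ s'.ireg 12 = n ∧
      ∀ q < 2 ^ L, s'.rmem 2 q =
        bucket n L (fun e => w (b * n + e)) (fun e => a (i * n + e)) q) := by
  refine exec_for (fun j s => Inv m n r L B w a i b c s ∧ s.ireg 12 = j ∧
    ∀ q < 2 ^ L, s.rmem 2 q = bucket j L (fun e => w (b * n + e)) (fun e => a (i * n + e)) q)
    (fun j s hI => ⟨hI.2.1, hI.1.h1⟩) ?_ ⟨hs, h12, by simpa [bucket] using hz⟩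
  rintro j s hj ⟨⟨⟩, h12, hz⟩
  refine exec_code ?_
  have := hW.le_n
  have := hW.le_nB
  have := hW.le_mn
  have := hW.pow_le
  have hbn : (b + 1) * n ≤ B * n := Nat.mul_le_mul_right n hb
  have hin : (i + 1) * n ≤ m * n := Nat.mul_le_mul_right n hi
  rw [Nat.add_mul, one_mul] at hbn hin
  have hwj : w (b * n + j) < 2 ^ L := hw _ (by omega)
  simp [codeWp, Instr.wp, IntOp.eval, RealOp.eval, Store.setReal, Function.update_apply, *]
  refine ⟨by omega, by omega, by omega, by omega, ⟨?_, ?_⟩⟩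
  · constructor <;> simp [*]
  · intro q hq
    have hsucc : bucket (j + 1) L (fun e => w (b * n + e)) (fun e => a (i * n + e)) q =
        bucket j L (fun e => w (b * n + e)) (fun e => a (i * n + e)) q +
          if w (b * n + j) = q then a (i * n + j) else 0 := by
      simp [bucket, Finset.sum_range_succ, Nat.mod_eq_of_lt hwj]
    rw [hsucc]
    by_cases h : q = w (b * n + j)
    · simp [h]
    · simp [h, Ne.symm h, hz q hq]

theorem exec_mergeLoop (hW : Fits W m n r L B) {h : ℕ} (hh : 2 * h ≤ 2 ^ L) {s : Store}
    (hs : Inv m n r L B w a i b c s) (h12 : s.ireg 12 = 0) (h13 : s.ireg 13 = h)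
    (h3 : s.rreg 3 = 0) {Z : ℕ → ℝ} (hz : ∀ q < 2 * h, s.rmem 2 q = Z q) :
    ∃ s', Exec W mergeLoop s (h * 16 + 1) s' ∧ (Inv m n r L B w a i b c s' ∧ s'.ireg 12 = h ∧
      s'.ireg 13 = h ∧ s'.rreg 3 = ∑ q ∈ Finset.range h, (Z (q + h) - Z q) ∧
      (∀ q < h, s'.rmem 2 q = Z q + Z (q + h)) ∧
      ∀ q, h ≤ q → q < 2 * h → s'.rmem 2 q = Z q) := by
  refine exec_for (fun j s => Inv m n r L B w a i b c s ∧ s.ireg 12 = j ∧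
    s.ireg 13 = h ∧ s.rreg 3 = ∑ q ∈ Finset.range j, (Z (q + h) - Z q) ∧
      (∀ q < j, s.rmem 2 q = Z q + Z (q + h)) ∧
      ∀ q, j ≤ q → q < 2 * h → s.rmem 2 q = Z q)
    (fun j s hI => ⟨hI.2.1, hI.2.2.1⟩) ?_ ⟨hs, h12, h13, by simpa using h3, by simp, by simpa using hz⟩
  clear hs h12 h13 h3 hz s
  rintro j s hj ⟨⟨⟩, h12, h13, h3, hlo, hhi⟩
  refine exec_code ?_
  have := hW.le_n
  have := hW.pow_le
  have e1 := hhi j le_rfl (by omega)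
  have e2 := hhi (j + h) (by omega) (by omega)
  simp [codeWp, Instr.wp, IntOp.eval, RealOp.eval, Store.setReal, Function.update_apply,
    Finset.sum_range_succ, *]
  refine ⟨by omega, by omega, ⟨?_, by ring, ?_, ?_⟩⟩
  · constructor <;> simp [*]
  · intro q hq
    by_cases hqj : q = j
    · simp [hqj]
    · simp [hqj, hlo q (by omega)]
  · intro q hq hq2
    have hqj : q ≠ j := by omega
    simp [hqj, hhi q (by omega) hq2]

theorem exec_foldLoop (hW : Fits W m n r L B) (hi : i < m) (hb : b < B) {s : Store}
    (hs : Inv m n r L B w a i b (b * L) s) (h13 : s.ireg 13 = 2 ^ L)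
    (hz : ∀ q < 2 ^ L, s.rmem 2 q =
      bucket n L (fun e => w (b * n + e)) (fun e => a (i * n + e)) q) :
    ∃ s', Exec W foldLoop s (49 * n) s' ∧ Inv m n r L B w a i b ((b + 1) * L) s' := by
  have hpn := hW.pow_le
  have hL : L < 2 ^ L := Nat.lt_two_pow_self
  obtain ⟨s', hE, hI, -⟩ := exec_while (W := W) (b := .intLt 4 13)
    (p := .seq (code (.intConst 14 2) [.intOp .div 13 13 14, .realOp .add 3 6 6, .intConst 12 0])
      (.seq mergeLoop (code (.realOp .div 3 3 5) [.realStore 1 15 3, .intOp .add 15 15 4])))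
    (t := fun t => 2 ^ (L - 1 - t) * 16 + 15) (N := L)
    (fun t s => Inv m n r L B w a i b (b * L + t) s ∧ s.ireg 13 = 2 ^ (L - t) ∧ t ≤ L ∧
      ∀ q < 2 ^ (L - t), s.rmem 2 q =
        bucket n (L - t) (fun e => w (b * n + e)) (fun e => a (i * n + e)) q)
    (by
      rintro t s ⟨hI, h13, ht, -⟩
      simp only [Test.holds, hI.h4, h13]
      rw [Nat.one_lt_two_pow_iff]
      omega)
    (by
      clear hs h13 hz s
      rintro t s ht ⟨hI, h13, -, hz⟩
      obtain ⟨l, hl⟩ : ∃ l, L - t = l + 1 := ⟨L - t - 1, by omega⟩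
      have hl1 : L - 1 - t = l := by omega
      have hl2 : L - (t + 1) = l := by omega
      rw [hl] at h13 hz
      rw [hl1, hl2]
      have hlL : 2 ^ (l + 1) ≤ 2 ^ L := Nat.pow_le_pow_right (by norm_num) (by omega)
      have hpl : 2 ^ (l + 1) = 2 * 2 ^ l := by rw [pow_succ, mul_comm]
      have hlW : 2 ^ l ≤ W := by have := hW.le_n; omega
      have h2W := hW.two_le
      obtain ⟨s₁, hE₁, hI₁, h12₁, h13₁, h3₁, hz₁⟩ := exec_code (W := W) (i := .intConst 14 2)
        (l := [.intOp .div 13 13 14, .realOp .add 3 6 6, .intConst 12 0]) (s := s)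
        (Q := fun s => Inv m n r L B w a i b (b * L + t) s ∧ s.ireg 12 = 0 ∧ s.ireg 13 = 2 ^ l ∧
          s.rreg 3 = 0 ∧ ∀ q < 2 * 2 ^ l, s.rmem 2 q =
            bucket n (l + 1) (fun e => w (b * n + e)) (fun e => a (i * n + e)) q) (by
          rw [hpl] at h13 hz
          obtain ⟨⟩ := hI
          simp [codeWp, Instr.wp, IntOp.eval, RealOp.eval, Store.setReal, *]
          refine ⟨?_, ?_⟩
          · constructor <;> simp [*]
          · simpa using hz)
      obtain ⟨s₂, hE₂, hI₂, h12₂, h13₂, h3₂, hz₂, -⟩ :=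
        exec_mergeLoop hW (by omega) hI₁ h12₁ h13₁ h3₁ hz₁
      rw [sum_bucket_sub] at h3₂
      have hout := hI₂.hout.update
      -- Bits are consumed from the highest down, so round t of block b yields column bL + t from
      -- bit L - 1 - t.
      have hent : entry n r L w a i (b * L + t) = s₂.rreg 3 / √r := by
        have hdiv : (b * L + t) / L = b := by
          rw [mul_comm, Nat.mul_add_div (by omega), Nat.div_eq_of_lt ht, add_zero]
        have hmod : (b * L + t) % L = t := by
          rw [mul_comm, Nat.mul_add_mod, Nat.mod_eq_of_lt ht]
        rw [entry, hdiv, hmod, hl1, h3₂]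
      have hbL : (b + 1) * L ≤ B * L := Nat.mul_le_mul_right L hb
      have hir : i * r ≤ m * r := Nat.mul_le_mul_right r hi.le
      rw [Nat.add_mul, one_mul] at hbL
      have hoW := hW.le_out
      obtain ⟨s₃, hE₃, hI₃, h13₃, hz₃⟩ := exec_code (W := W) (i := .realOp .div 3 3 5)
        (l := [.realStore 1 15 3, .intOp .add 15 15 4]) (s := s₂)
        (Q := fun s => Inv m n r L B w a i b (b * L + (t + 1)) s ∧ s.ireg 13 = 2 ^ l ∧
          ∀ q < 2 ^ l, s.rmem 2 q =
            bucket n l (fun e => w (b * n + e)) (fun e => a (i * n + e)) q) (by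
          obtain ⟨⟩ := hI₂
          simp [codeWp, Instr.wp, IntOp.eval, RealOp.eval, Store.setReal, *]
          refine ⟨by omega, ?_, ?_⟩
          · rw [hent, h3₂, add_assoc] at hout
            constructor <;> simp [*, add_assoc]
          · intro q hq
            rw [hz₂ q hq]
            exact bucket_add _ _ hq)
      refine ⟨s₃, ((hE₁.seq (hE₂.seq hE₃)).mono ?_), hI₃, h13₃, by omega, hz₃⟩
      simp only [List.length_cons, List.length_nil]
      omega)
    (s := s) ⟨hs, by simpa using h13, by omega, by simpa using hz⟩
  refine ⟨s', hE.mono ?_, by rwa [Nat.add_mul, one_mul]⟩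
  -- The halving bucket sizes sum to less than 2^L ≤ n, so all L columns of the block together cost
  -- O(n).
  have hgeom : ∑ t ∈ Finset.range L, 2 ^ (L - 1 - t) < 2 ^ L := by
    rw [Finset.sum_range_reflect (fun t => 2 ^ t) L]
    exact Nat.geomSum_lt le_rfl (by simp)
  simp only [Finset.sum_add_distrib, ← Finset.sum_mul, Finset.sum_const, Finset.card_range,
    smul_eq_mul]
  omega

theorem exec_blockLoop (hW : Fits W m n r L B) (hi : i < m) (hw : ∀ q < B * n, w q < 2 ^ L)
    {s : Store} (hs : Inv m n r L B w a i 0 0 s) :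
    ∃ s', Exec W blockLoop s (B * (100 * n) + 1) s' ∧ Inv m n r L B w a i B (B * L) s' := by
  have hpn := hW.pow_le
  have hL : L < 2 ^ L := Nat.lt_two_pow_self
  have hnW := hW.le_n
  obtain ⟨s', hE, hI⟩ := exec_for (W := W) (x := 11) (y := 7) (N := B) (t := 100 * n - 1)
    (p := .seq (.instr (.intConst 12 0)) (.seq clearLoop
    (.seq (.instr (.intConst 12 0)) (.seq fillLoop (.seq (.instr (.intOp .add 13 5 9))
      (.seq foldLoop (code (.intOp .add 17 17 1) [.intOp .add 11 11 4])))))))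
    (fun b s => Inv m n r L B w a i b (b * L) s) (fun b s hI => ⟨hI.h11, hI.h7⟩)
    (by
      clear hs s
      intro b s hb hI
      obtain ⟨s₁, hE₁, hI₁, h12₁⟩ := exec_instr (W := W) (i := .intConst 12 0) (s := s)
        (Q := fun s => Inv m n r L B w a i b (b * L) s ∧ s.ireg 12 = 0) (by
          obtain ⟨⟩ := hI
          simp [Instr.wp]
          constructor <;> simp [*])
      obtain ⟨s₂, hE₂, hI₂, -, hz₂⟩ := exec_clearLoop hW hI₁ h12₁
      obtain ⟨s₃, hE₃, hI₃, h12₃, hz₃⟩ := exec_instr (W := W) (i := .intConst 12 0) (s := s₂)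
        (Q := fun s => Inv m n r L B w a i b (b * L) s ∧ s.ireg 12 = 0 ∧
          ∀ q < 2 ^ L, s.rmem 2 q = 0) (by
          obtain ⟨⟩ := hI₂
          simp [Instr.wp]
          refine ⟨?_, hz₂⟩
          constructor <;> simp [*])
      obtain ⟨s₄, hE₄, hI₄, -, hz₄⟩ := exec_fillLoop hW hi hb hw hI₃ h12₃ hz₃
      obtain ⟨s₅, hE₅, hI₅, h13₅, hz₅⟩ := exec_instr (W := W) (i := .intOp .add 13 5 9) (s := s₄)
        (Q := fun s => Inv m n r L B w a i b (b * L) s ∧ s.ireg 13 = 2 ^ L ∧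
          ∀ q < 2 ^ L, s.rmem 2 q =
            bucket n L (fun e => w (b * n + e)) (fun e => a (i * n + e)) q) (by
          obtain ⟨⟩ := hI₄
          simp [Instr.wp, IntOp.eval, *]
          refine ⟨by omega, ?_, ?_⟩
          · constructor <;> simp [*]
          · simpa using hz₄)
      obtain ⟨s₆, hE₆, hI₆⟩ := exec_foldLoop hW hi hb hI₅ h13₅ hz₅
      have hbn : (b + 1) * n ≤ B * n := Nat.mul_le_mul_right n hb
      rw [Nat.add_mul, one_mul] at hbn
      have hnB := hW.le_nB
      have hBW := hW.le_B
      obtain ⟨s₇, hE₇, hI₇⟩ := exec_code (W := W) (i := .intOp .add 17 17 1)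
        (l := [.intOp .add 11 11 4]) (s := s₆)
        (Q := fun s => Inv m n r L B w a i (b + 1) ((b + 1) * L) s) (by
          obtain ⟨⟩ := hI₆
          simp [codeWp, Instr.wp, IntOp.eval, *]
          refine ⟨by omega, by omega, ?_⟩
          constructor <;> first | assumption | simp [*, Nat.add_mul])
      refine ⟨s₇, ((hE₁.seq (hE₂.seq (hE₃.seq (hE₄.seq (hE₅.seq (hE₆.seq hE₇)))))).mono ?_), hI₇⟩
      simp only [List.length_cons, List.length_nil]
      omega)
    (s := s) (by simpa using hs)
  refine ⟨s', hE.mono ?_, hI⟩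
  rw [Nat.sub_add_cancel (by omega)]

/-- The register contents before the processing of row `i`. -/
structure RowInv (m n r L B : ℕ) (w : ℕ → ℕ) (a : ℕ → ℝ) (i : ℕ) (s : Store) : Prop where
  h0 : s.ireg 0 = m
  h1 : s.ireg 1 = n
  h3 : s.ireg 3 = r
  h4 : s.ireg 4 = 1
  h5 : s.ireg 5 = 2 ^ L
  h7 : s.ireg 7 = B
  h9 : s.ireg 9 = 0
  h10 : s.ireg 10 = i
  hsqrt : s.rreg 5 = √r
  hzero : s.rreg 6 = 0
  himem : s.imem 0 = w
  hrmem : s.rmem 0 = a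
  hout : Written n r L w a i 0 (s.rmem 1)

theorem exec_rowLoop (hW : Fits W m n r L B) (hw : ∀ q < B * n, w q < 2 ^ L) (hr : r ≤ B * L)
    {s : Store} (hs : RowInv m n r L B w a 0 s) :
    ∃ s', Exec W rowLoop s (m * (B * (100 * n) + 13) + 1) s' ∧ RowInv m n r L B w a m s' := by
  refine exec_for (fun i s => RowInv m n r L B w a i s) (fun i s hI => ⟨hI.h10, hI.h0⟩) ?_ hs
  clear hs s
  intro i s hi hI
  have hin : i * n ≤ m * n := Nat.mul_le_mul_right n hi.le
  have hir : i * r ≤ m * r := Nat.mul_le_mul_right r hi.le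
  have hmn := hW.le_mn
  have hoW := hW.le_out
  have hmW := hW.le_m
  obtain ⟨s₁, hE₁, hI₁⟩ := exec_code (W := W) (i := .intOp .mul 16 10 1)
    (l := [.intOp .mul 15 10 3, .intConst 17 0, .intConst 11 0]) (s := s)
    (Q := Inv m n r L B w a i 0 0) (by
      obtain ⟨⟩ := hI
      simp [codeWp, Instr.wp, IntOp.eval, *]
      refine ⟨by omega, by omega, ?_⟩
      constructor <;> simp [*])
  obtain ⟨s₂, hE₂, hI₂⟩ := exec_blockLoop hW hi hw hI₁
  obtain ⟨s₃, hE₃, hI₃⟩ := exec_instr (W := W) (i := .intOp .add 10 10 4) (s := s₂)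
    (Q := RowInv m n r L B w a (i + 1)) (by
      have hout := hI₂.hout.next_row hr
      obtain ⟨⟩ := hI₂
      simp [Instr.wp, IntOp.eval, *]
      refine ⟨by omega, ?_⟩
      constructor <;> simp [*])
  refine ⟨s₃, ((hE₁.seq (hE₂.seq hE₃)).mono ?_), hI₃⟩
  simp only [List.length_cons, List.length_nil]
  omega

end Mailman

end RealRAM

/-! ### Uniform distributions -/

namespace PMF

theorem eq_uniformOfFintype {β : Type*} [Fintype β] [Nonempty β] {p : PMF β}
    (h : ∀ y y', p y = p y') : p = uniformOfFintype β := by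
  ext y
  rw [uniformOfFintype_apply]
  have hsum := p.tsum_coe
  rw [tsum_fintype, Finset.sum_congr rfl fun y' _ => h y' y, Finset.sum_const, Finset.card_univ,
    nsmul_eq_mul, mul_comm] at hsum
  exact ENNReal.eq_inv_of_mul_eq_one_left hsum

/-- A permutation carries each fibre onto any other, so all fibres have the same mass. -/
theorem map_uniformOfFintype {α β : Type*} [Fintype α] [Nonempty α] [Fintype β] [Nonempty β]
    (φ : α → β) (h : ∀ y y', ∃ σ : α ≃ α, ∀ a, φ (σ a) = y' ↔ φ a = y) :
    (uniformOfFintype α).map φ = uniformOfFintype β := by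
  refine eq_uniformOfFintype fun y y' => ?_
  obtain ⟨σ, hσ⟩ := h y' y
  simp only [map_apply, uniformOfFintype_apply]
  rw [← σ.tsum_eq]
  refine tsum_congr fun a => ?_
  by_cases hy : y' = φ a
  · rw [if_pos hy, if_pos ((hσ a).2 hy.symm).symm]
  · rw [if_neg hy, if_neg fun h => hy ((hσ a).1 h.symm).symm]

theorem uniformOfFinset_range {M : ℕ} [NeZero M] (h : (Finset.range M).Nonempty) :
    uniformOfFinset (Finset.range M) h = (uniformOfFintype (Fin M)).map Fin.val := by
  ext x
  simp only [map_apply, uniformOfFintype_apply, uniformOfFinset_apply, tsum_fintype]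
  by_cases hx : x < M
  · rw [Finset.sum_eq_single_of_mem (⟨x, hx⟩ : Fin M) (Finset.mem_univ _)]
    · simp [hx]
    · intro c _ hc
      rw [if_neg]
      rintro rfl
      exact hc rfl
  · rw [if_neg (by simpa using hx)]
    refine (Finset.sum_eq_zero fun c _ => ?_).symm
    rw [if_neg]
    rintro rfl
    exact hx c.2

theorem uniformOfFintype_bind_cons {β : Type*} [Fintype β] [Nonempty β] (d : ℕ) :
    ((uniformOfFintype β).bind fun c => (uniformOfFintype (Fin d → β)).map
      fun v => (Fin.cons c v : Fin (d + 1) → β)) = uniformOfFintype (Fin (d + 1) → β) := by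
  refine eq_uniformOfFintype ?_
  have key : ∀ v : Fin (d + 1) → β, ((uniformOfFintype β).bind fun c =>
      (uniformOfFintype (Fin d → β)).map fun v => (Fin.cons c v : Fin (d + 1) → β)) v =
      (Fintype.card β : ENNReal)⁻¹ * (Fintype.card (Fin d → β) : ENNReal)⁻¹ := by
    intro v
    simp only [bind_apply, map_apply, uniformOfFintype_apply, tsum_fintype]
    rw [Finset.sum_eq_single_of_mem (v 0) (Finset.mem_univ _)]
    · rw [Finset.sum_eq_single_of_mem (Fin.tail v) (Finset.mem_univ _)]
      · rw [if_pos (Fin.cons_self_tail v).symm]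
      · intro u _ hu
        rw [if_neg]
        intro h
        exact hu (by rw [h, Fin.tail_cons])
    · intro c _ hc
      rw [Finset.sum_eq_zero, mul_zero]
      intro u _
      rw [if_neg]
      intro h
      exact hc (by rw [h, Fin.cons_zero])
  intro y y'
  rw [key, key]

theorem bind_congr_support {α β : Type*} (p : PMF α) {f g : α → PMF β}
    (h : ∀ a ∈ p.support, f a = g a) : p.bind f = p.bind g := by
  ext b
  simp only [bind_apply]
  refine tsum_congr fun a => ?_
  by_cases ha : p a = 0
  · simp [ha]
  · rw [h a ha]

end PMF

namespace RealRAM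

open Rademacher (sgn)

namespace Mailman

/-! ### Drawing the random words -/

/-- The law of a memory after `d` words of `l` bits have been drawn into the cells from `j` on. -/
noncomputable def draws (l : ℕ) : ℕ → ℕ → (ℕ → ℕ) → PMF (ℕ → ℕ)
  | _, 0, f => PMF.pure f
  | j, d + 1, f => (PMF.uniformOfFintype (Fin (2 ^ l))).bind fun c =>
      draws l (j + 1) d (Function.update f j c)

/-- The memory obtained by writing the words `v` into the cells from `j` on. -/
def overwrite {l d : ℕ} (j : ℕ) (f : ℕ → ℕ) (v : Fin d → Fin (2 ^ l)) (q : ℕ) : ℕ :=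
  if h : j ≤ q ∧ q < j + d then v ⟨q - j, by omega⟩ else f q

theorem overwrite_cons {l d : ℕ} (j : ℕ) (f : ℕ → ℕ) (c : Fin (2 ^ l)) (v : Fin d → Fin (2 ^ l)) :
    overwrite j f (Fin.cons c v : Fin (d + 1) → Fin (2 ^ l)) =
      overwrite (j + 1) (Function.update f j c) v := by
  ext q
  unfold overwrite
  rcases lt_trichotomy q j with h | rfl | h
  · rw [dif_neg (by omega), dif_neg (by omega), Function.update_of_ne (by omega)]
  · rw [dif_pos (by omega), dif_neg (by omega), Function.update_self]
    simp
  · by_cases h2 : q < j + (d + 1)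
    · rw [dif_pos (by omega), dif_pos (by omega)]
      have : (⟨q - j, by omega⟩ : Fin (d + 1)) = Fin.succ ⟨q - (j + 1), by omega⟩ := by
        ext
        simp
        omega
      rw [this, Fin.cons_succ]
    · rw [dif_neg (by omega), dif_neg (by omega), Function.update_of_ne (by omega)]

theorem draws_eq_map (l j d : ℕ) (f : ℕ → ℕ) :
    draws l j d f = (PMF.uniformOfFintype (Fin d → Fin (2 ^ l))).map (overwrite j f) := by
  induction d generalizing j f with
  | zero =>
    have : (overwrite j f : (Fin 0 → Fin (2 ^ l)) → ℕ → ℕ) = Function.const _ f := by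
      ext v q
      rw [overwrite, dif_neg (by omega), Function.const_apply]
    rw [this, PMF.map_const]
    rfl
  | succ d ih =>
    rw [draws, ← PMF.uniformOfFintype_bind_cons, PMF.map_bind]
    congr 1
    ext1 c
    rw [ih, PMF.map_comp]
    congr 1
    ext1 v
    exact (overwrite_cons j f c v).symm

/-- The register contents when the parameters have been computed and `j` words have been drawn. -/
structure DrawInv (m n r L B : ℕ) (a : ℕ → ℝ) (j : ℕ) (s : Store) : Prop where
  h0 : s.ireg 0 = m
  h1 : s.ireg 1 = n
  h3 : s.ireg 3 = r
  h4 : s.ireg 4 = 1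
  h5 : s.ireg 5 = 2 ^ L
  h7 : s.ireg 7 = B
  h8 : s.ireg 8 = B * n
  h9 : s.ireg 9 = 0
  h10 : s.ireg 10 = 0
  h12 : s.ireg 12 = j
  hsqrt : s.rreg 5 = √r
  hzero : s.rreg 6 = 0
  hrmem : s.rmem 0 = a

/-- Draw the words that encode the random signs. -/
def drawLoop : Program :=
  .while (.intLt 12 8) (.seq (.instr (.rand 14 5)) (code (.intStore 0 12 14) [.intOp .add 12 12 4]))

theorem exec_rand {W M x y : ℕ} [NeZero M] {s : Store} (hy : s.ireg y = M) (hM : M ≤ W) :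
    Instr.exec W (.rand x y) s = (PMF.uniformOfFintype (Fin M)).map
      fun c => some { s with ireg := Function.update s.ireg x c } := by
  subst hy
  rw [Instr.exec, dif_pos (Nat.pos_of_ne_zero (NeZero.ne _))]
  refine (congrArg (PMF.map _) (PMF.uniformOfFinset_range _)).trans ?_
  rw [PMF.map_comp]
  congr 1
  ext1 c
  simp only [Function.comp_apply, Store.setInt]
  rw [if_pos (c.2.le.trans hM)]

variable {W m n r L B : ℕ} {a : ℕ → ℝ}

/-- Every round takes exactly 6 steps whatever is drawn, so the machine can be resumed at one common
time from a random store. Only the law of the word memory is tracked; the registers are the same in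
every outcome. -/
theorem run_drawLoop (hW : Fits W m n r L B) (d j : ℕ) (s : Store) (hjd : j + d = B * n)
    (hs : DrawInv m n r L B a j s) :
    ∃ μ : PMF Store, (∀ K T, run W (d * 6 + 1 + T) (some (drawLoop :: K, s)) =
        μ.bind fun s' => run W T (some (K, s'))) ∧
      (∀ s' ∈ μ.support, DrawInv m n r L B a (B * n) s') ∧
      μ.map (fun s' => s'.imem 0) = draws L j d (s.imem 0) := by
  induction d generalizing j s with
  | zero =>
    obtain rfl : j = B * n := hjd
    refine ⟨PMF.pure s, fun K T => ?_, by simpa using hs, by rw [PMF.pure_map]; rfl⟩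
    rw [PMF.pure_bind, zero_mul, zero_add]
    exact run_while_false (by simp [Test.holds, hs.h12, hs.h8]) K T
  | succ d ih =>
    have hpn := hW.pow_le
    have hnW := hW.le_n
    have hnB := hW.le_nB
    have hstep : ∀ c : Fin (2 ^ L), ∃ s', (∀ K T,
        run W (3 + T) (some (code (.intStore 0 12 14) [.intOp .add 12 12 4] :: K,
          { s with ireg := Function.update s.ireg 14 c })) = run W T (some (K, s'))) ∧
        (DrawInv m n r L B a (j + 1) s' ∧ s'.imem 0 = Function.update (s.imem 0) j c) := by
      intro c
      obtain ⟨s', h₁, h₂⟩ := exists_run_code (W := W) (i := .intStore 0 12 14)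
        (l := [.intOp .add 12 12 4]) (s := { s with ireg := Function.update s.ireg 14 c })
        (Q := fun s' => DrawInv m n r L B a (j + 1) s' ∧
          s'.imem 0 = Function.update (s.imem 0) j c) (by
          obtain ⟨⟩ := hs
          simp [codeWp, Instr.wp, IntOp.eval, *]
          refine ⟨by omega, ?_⟩
          constructor <;> simp [*])
      exact ⟨s', h₁, h₂⟩
    choose s₁ hrun hinv himem using hstep
    choose μ hμ hsupp hmap using fun c => ih (j + 1) (s₁ c) (by omega) (hinv c)
    refine ⟨(PMF.uniformOfFintype (Fin (2 ^ L))).bind μ, fun K T => ?_, ?_, ?_⟩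
    · have h1 : (d + 1) * 6 + 1 + T = 1 + (1 + (1 + (3 + (d * 6 + 1 + T)))) := by ring
      rw [h1, drawLoop, run_while_true (by simp only [Test.holds, hs.h12, hs.h8]; omega),
        run_succ_of_step_eq (c' := some (.instr (.rand 14 5) ::
          code (.intStore 0 12 14) [.intOp .add 12 12 4] :: drawLoop :: K, s)) rfl,
        add_comm 1, run, step, exec_rand hs.h5 (hpn.trans hnW), PMF.map_comp, PMF.bind_map,
        PMF.bind_bind]
      congr 1
      ext1 c
      rw [← hμ, ← hrun]
      rfl
    · intro s' hs'
      obtain ⟨c, -, hc⟩ := (PMF.mem_support_bind_iff _ _ _).1 hs'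
      exact hsupp c s' hc
    · rw [PMF.map_bind, draws]
      congr 1
      ext1 c
      rw [hmap, himem]

/-! ### Computing the parameters -/

/-- Count up to the number `r` of random features. -/
def countLoop : Program :=
  .while (.realLt 3 2) (code (.intOp .add 3 3 4) [.ofInt 3 3])

/-- Find the largest power of two that is at most `n`, and its exponent. -/
def doubleLoop : Program :=
  .while (.intLt 5 14) (code (.intOp .add 5 5 5) [.intOp .add 6 6 4])

/-- Compute the parameters of the algorithm. -/
def prepare (c : ℕ) : Program :=
  .seq (code (.intConst 4 1) [.intConst 5 c, .intOp .mul 5 5 2, .ofInt 2 5, .realOp .mul 1 0 0,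
    .realOp .div 2 2 1]) (.seq countLoop (.seq (code (.ofInt 5 3) [.sqrt 5 5, .intConst 5 1,
      .intConst 14 2, .intOp .div 14 1 14, .intOp .add 14 14 4]) (.seq doubleLoop
        (code (.intOp .div 7 3 6) [.intOp .add 7 7 4, .intOp .mul 8 7 1]))))

/-- The complete program. -/
def program (c : ℕ) : Program := .seq (prepare c) (.seq drawLoop rowLoop)

/-- The register contents while the parameters are being computed. -/
structure PrepInv (m n r M l : ℕ) (a : ℕ → ℝ) (s : Store) : Prop where
  h0 : s.ireg 0 = m
  h1 : s.ireg 1 = n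
  h3 : s.ireg 3 = r
  h4 : s.ireg 4 = 1
  h5 : s.ireg 5 = M
  h6 : s.ireg 6 = l
  h9 : s.ireg 9 = 0
  h10 : s.ireg 10 = 0
  h12 : s.ireg 12 = 0
  hzero : s.rreg 6 = 0
  hrmem : s.rmem 0 = a
  himem : s.imem 0 = fun _ => 0

theorem exec_prepare {c k : ℕ} {ε : ℝ} (A : Matrix (Fin m) (Fin n) ℝ)
    (hr : r = ⌈(c : ℝ) * k / ε ^ 2⌉₊) (hL : L = Nat.log 2 n) (hB : B = r / L + 1)
    (hW : Fits W m n r L B) (hc : c ≤ W) (hck : c * k ≤ W) (hrW : r ≤ W) :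
    ∃ s', Exec W (prepare c) (inputStore A k ε) (4 * r + 4 * n + 60) s' ∧
      (DrawInv m n r L B ((inputStore A k ε).rmem 0) 0 s' ∧ s'.imem 0 = fun _ => 0) := by
  subst hB
  have h2 := hW.two_le
  have hnW := hW.le_n
  have hpn := hW.pow_le
  have hn0 : n ≠ 0 := by
    have : 0 < 2 ^ L := by positivity
    omega
  have hLn : L < 2 ^ L := Nat.lt_two_pow_self
  set a := (inputStore A k ε).rmem 0 with ha
  set X : ℝ := (c : ℝ) * k / ε ^ 2 with hX
  obtain ⟨s₁, hE₁, hI₁, hr2₁, hr3₁⟩ := exec_code (W := W) (i := .intConst 4 1)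
    (l := [.intConst 5 c, .intOp .mul 5 5 2, .ofInt 2 5, .realOp .mul 1 0 0, .realOp .div 2 2 1])
    (s := inputStore A k ε)
    (Q := fun s => PrepInv m n 0 (c * k) 0 a s ∧ s.rreg 2 = X ∧ s.rreg 3 = ((0 : ℕ) : ℝ)) (by
      have e2 : (inputStore A k ε).ireg 2 = k := rfl
      have er : (inputStore A k ε).rreg 0 = ε := rfl
      simp [codeWp, Instr.wp, IntOp.eval, RealOp.eval, Store.setReal, e2, er]
      refine ⟨by omega, hc, hck, ?_, by rw [hX, sq], rfl⟩
      constructor <;> simp [inputStore, ha])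
  obtain ⟨s₂, hE₂, hI₂, -, -⟩ := exec_while (W := W) (b := .realLt 3 2) (N := r) (t := fun _ => 3)
    (p := code (.intOp .add 3 3 4) [.ofInt 3 3]) (s := s₁)
    (fun j s => PrepInv m n j (c * k) 0 a s ∧ s.rreg 2 = X ∧ s.rreg 3 = j)
    (by
      rintro j s ⟨-, h2, h3⟩
      simp only [Test.holds, h2, h3, hr, Nat.lt_ceil])
    (by
      rintro j s hj ⟨hI, h2, h3⟩
      refine exec_code ?_
      obtain ⟨⟩ := hI
      simp [codeWp, Instr.wp, IntOp.eval, Store.setReal, *]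
      refine ⟨by omega, ?_⟩
      constructor <;> simp [*])
    ⟨hI₁, hr2₁, hr3₁⟩
  obtain ⟨s₃, hE₃, hI₃, h14₃, hs₃⟩ := exec_code (W := W) (i := .ofInt 5 3)
    (l := [.sqrt 5 5, .intConst 5 1, .intConst 14 2, .intOp .div 14 1 14, .intOp .add 14 14 4])
    (s := s₂)
    (Q := fun s => PrepInv m n r (2 ^ 0) 0 a s ∧ s.ireg 14 = n / 2 + 1 ∧ s.rreg 5 = √r) (by
      obtain ⟨⟩ := hI₂
      simp [codeWp, Instr.wp, IntOp.eval, Store.setReal, *]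
      refine ⟨by omega, by omega, by omega, ?_⟩
      constructor <;> simp [*])
  obtain ⟨s₄, hE₄, hI₄, -, hs₄⟩ := exec_while (W := W) (b := .intLt 5 14) (N := L) (t := fun _ => 3)
    (p := code (.intOp .add 5 5 5) [.intOp .add 6 6 4]) (s := s₃)
    (fun j s => PrepInv m n r (2 ^ j) j a s ∧ s.ireg 14 = n / 2 + 1 ∧ s.rreg 5 = √r)
    (by
      rintro j s ⟨hI, h14, -⟩
      simp only [Test.holds, hI.h5, h14]
      -- The loop compares 2^j with n/2 + 1 because 2^j < n/2 + 1 means 2^(j+1) ≤ n, that is, j <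
      -- log₂ n; no power above n is formed.
      rw [hL, ← Nat.succ_le_iff (m := j), Nat.le_log_iff_pow_le (by norm_num) hn0, Nat.pow_succ]
      omega)
    (by
      rintro j s hj ⟨hI, h14, hs⟩
      have hj2 : 2 ^ (j + 1) ≤ 2 ^ L := Nat.pow_le_pow_right (by norm_num) hj
      rw [pow_succ] at hj2
      refine exec_code ?_
      obtain ⟨⟩ := hI
      simp [codeWp, Instr.wp, IntOp.eval, *]
      refine ⟨by omega, by omega, ?_⟩
      constructor <;> simp [*, pow_succ, mul_two])
    ⟨hI₃, h14₃, hs₃⟩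
  have hBW := hW.le_B
  have hnB := hW.le_nB
  obtain ⟨s₅, hE₅, hI₅⟩ := exec_code (W := W) (i := .intOp .div 7 3 6)
    (l := [.intOp .add 7 7 4, .intOp .mul 8 7 1]) (s := s₄)
    (Q := fun s => DrawInv m n r L (r / L + 1) a 0 s ∧ s.imem 0 = fun _ => 0) (by
      clear hL hr
      obtain ⟨⟩ := hI₄
      simp [codeWp, Instr.wp, IntOp.eval, *]
      refine ⟨by omega, ?_⟩
      constructor <;> simp [*])
  refine ⟨s₅, ((hE₁.seq (hE₂.seq (hE₃.seq (hE₄.seq hE₅)))).mono ?_), hI₅⟩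
  simp only [List.length_cons, List.length_nil, Finset.sum_const, Finset.card_range, smul_eq_mul]
  omega

/-! ### The law of the output -/

theorem word_index_lt {n r L B : ℕ} (hr : r ≤ B * L) (e : Fin n) (j : Fin r) :
    (j / L * n + e : ℕ) < B * n := by
  have h1 : (j : ℕ) / L < B := Nat.div_lt_of_lt_mul (by rw [mul_comm]; exact j.2.trans_le hr)
  have h2 : ((j : ℕ) / L + 1) * n ≤ B * n := Nat.mul_le_mul_right n h1
  rw [Nat.add_mul, one_mul] at h2
  have := e.2
  omega

/-- The signs encoded by the words `v`. -/
def signsOfWords {n r L B : ℕ} (hr : r ≤ B * L) (v : Fin (B * n) → Fin (2 ^ L)) (e : Fin n)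
    (j : Fin r) : Bool :=
  (v ⟨j / L * n + e, word_index_lt hr e j⟩ : ℕ).testBit (L - 1 - j % L)

theorem signsOfWords_surjective (hr : r ≤ B * L) :
    Function.Surjective (signsOfWords (n := n) hr) := by
  intro y
  -- Word q serves row q % n in block q / n, and its bit t serves the column with offset L - 1 - t.
  -- Bits for columns from r on are unconstrained and set to `false`.
  refine ⟨fun q => ⟨Nat.ofBits fun t : Fin L =>
    if h : q % n < n ∧ q / n * L + (L - 1 - t) < r then y ⟨q % n, h.1⟩ ⟨_, h.2⟩ else false,
    Nat.ofBits_lt_two_pow _⟩, ?_⟩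
  ext e j
  have hL : 0 < L := by
    rcases Nat.eq_zero_or_pos L with h | h
    · subst h
      have := j.2
      omega
    · exact h
  have hmod : (j : ℕ) % L < L := Nat.mod_lt _ hL
  have e1 : (j / L * n + e : ℕ) % n = e := by
    rw [mul_comm, Nat.mul_add_mod, Nat.mod_eq_of_lt e.2]
  have e2 : (j / L * n + e : ℕ) / n = j / L := by
    rw [mul_comm, Nat.mul_add_div (by have := e.2; omega), Nat.div_eq_of_lt e.2, add_zero]
  have e3 : (j / L * L + (L - 1 - (L - 1 - j % L)) : ℕ) = j := by
    have := Nat.div_add_mod' (j : ℕ) L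
    omega
  rw [signsOfWords]
  simp only
  rw [Nat.testBit_ofBits_lt _ _ (by omega)]
  simp only [e1, e2, e3]
  rw [dif_pos ⟨e.2, j.2⟩]

/-- Bitwise addition of fixed words. -/
def xorWords {d l : ℕ} (u : Fin d → Fin (2 ^ l)) : (Fin d → Fin (2 ^ l)) ≃ (Fin d → Fin (2 ^ l)) :=
  Function.Involutive.toPerm
    (fun v q => ⟨(v q : ℕ) ^^^ (u q : ℕ), Nat.xor_lt_two_pow (v q).2 (u q).2⟩)
    (fun v => by
      ext q
      simp)

/-- Reading signs from words turns bitwise addition of words into addition of signs. By surjectivity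
some word vector encodes y ⊕ y', and adding it exchanges the fibres over y and y'. -/
theorem map_signsOfWords (hr : r ≤ B * L) :
    (PMF.uniformOfFintype (Fin (B * n) → Fin (2 ^ L))).map (signsOfWords (n := n) hr) =
      PMF.uniformOfFintype (Fin n → Fin r → Bool) := by
  refine PMF.map_uniformOfFintype _ fun y y' => ?_
  obtain ⟨u, hu⟩ := signsOfWords_surjective hr (fun e j => xor (y e j) (y' e j))
  refine ⟨xorWords u, fun v => ?_⟩
  have hx : ∀ e j, signsOfWords hr (xorWords u v) e j =
      xor (signsOfWords hr v e j) (xor (y e j) (y' e j)) := by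
    intro e j
    rw [← congr_fun (congr_fun hu e) j]
    exact Nat.testBit_xor _ _ _
  simp only [funext_iff, hx]
  refine forall_congr' fun e => forall_congr' fun j => ?_
  cases signsOfWords hr v e j <;> cases y e j <;> cases y' e j <;> decide

theorem inputStore_rmem {k : ℕ} {ε : ℝ} (A : Matrix (Fin m) (Fin n) ℝ) (i : Fin m) (e : Fin n) :
    (inputStore A k ε).rmem 0 (i * n + e) = A i e := by
  have hlt : (i * n + e : ℕ) < m * n := by
    have h : ((i : ℕ) + 1) * n ≤ m * n := Nat.mul_le_mul_right n i.2
    rw [Nat.add_mul, one_mul] at h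
    have := e.2
    omega
  simp only [inputStore]
  rw [dif_pos hlt]
  congr 1
  · ext
    simp only [Fin.coe_divNat]
    rw [mul_comm, Nat.mul_add_div (by have := e.2; omega), Nat.div_eq_of_lt e.2, add_zero]
  · ext
    simp only [Fin.coe_modNat]
    rw [mul_comm, Nat.mul_add_mod, Nat.mod_eq_of_lt e.2]

theorem entry_overwrite {k : ℕ} {ε : ℝ} (A : Matrix (Fin m) (Fin n) ℝ) (hr : r ≤ B * L)
    (v : Fin (B * n) → Fin (2 ^ L)) (i : Fin m) (j : Fin r) :
    entry n r L (overwrite 0 (fun _ => 0) v) ((inputStore A k ε).rmem 0) i j =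
      (A * KMeans.signCols fun l e => signsOfWords hr v e l) i j := by
  rw [entry, Matrix.mul_apply, Finset.sum_range, Finset.sum_div]
  refine Finset.sum_congr rfl fun e _ => ?_
  rw [inputStore_rmem]
  have hw : overwrite 0 (fun _ => 0) v (j / L * n + e) =
      v ⟨j / L * n + e, word_index_lt hr e j⟩ := by
    have h := word_index_lt hr e j
    rw [overwrite, dif_pos ⟨Nat.zero_le _, by omega⟩]
    rfl
  rw [KMeans.signCols_apply, signsOfWords, hw, mul_div_assoc]

theorem overwrite_lt {d l : ℕ} (v : Fin d → Fin (2 ^ l)) (q : ℕ) :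
    overwrite 0 (fun _ => 0) v q < 2 ^ l := by
  rw [overwrite]
  split_ifs
  · exact (v _).2
  · positivity

theorem computes_features {c k : ℕ} {ε : ℝ} (A : Matrix (Fin m) (Fin n) ℝ)
    (hr : r = ⌈(c : ℝ) * k / ε ^ 2⌉₊) (hL : L = Nat.log 2 n) (hL0 : 0 < L) (hB : B = r / L + 1)
    (hW : Fits W m n r L B) (hc : c ≤ W) (hck : c * k ≤ W) (hrW : r ≤ W) {T : ℕ}
    (hT : (4 * r + 4 * n + 60) + (B * n * 6 + 1) + (m * (B * (100 * n) + 13) + 1) + 2 ≤ T) :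
    Computes (program c) W T A k ε r (KMeans.features A r) := by
  have hrBL : r ≤ B * L := by
    have := Nat.div_add_mod' r L
    have := Nat.mod_lt r hL0
    rw [hB, Nat.add_mul, one_mul]
    omega
  set a := (inputStore A k ε).rmem 0 with ha
  obtain ⟨s₁, ⟨t₁, ht₁, hE₁⟩, hI₁, himem₁⟩ := exec_prepare A hr hL hB hW hc hck hrW
  obtain ⟨μ, hμ, hsupp, hmap⟩ := run_drawLoop hW (B * n) 0 s₁ (zero_add _) hI₁
  rw [himem₁, draws_eq_map] at hmap
  -- Preparation and drawing take exact times. All remaining steps d go to the row loop, which needs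
  -- only an upper bound.
  obtain ⟨d, hd⟩ : ∃ d, T = 1 + (t₁ + (1 + (B * n * 6 + 1 + d))) :=
    ⟨T - (1 + (t₁ + (1 + (B * n * 6 + 1)))), by omega⟩
  have hd' : m * (B * (100 * n) + 13) + 1 ≤ d := by omega
  set mat : (ℕ → ℕ) → Matrix (Fin m) (Fin r) ℝ := fun w => Matrix.of fun i j => entry n r L w a i j
    with hmat
  have hrow : ∀ s ∈ μ.support, (run W d (some ([rowLoop], s))).map (output m r) =
      PMF.pure (some (mat (s.imem 0))) := by
    intro s hs
    have hI := hsupp s hs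
    have hw : ∀ q < B * n, s.imem 0 q < 2 ^ L := by
      intro q _
      have hmem : s.imem 0 ∈ (μ.map fun s' => s'.imem 0).support :=
        (PMF.mem_support_map_iff _ _ _).2 ⟨s, hs, rfl⟩
      rw [hmap] at hmem
      obtain ⟨v, -, hv⟩ := (PMF.mem_support_map_iff _ _ _).1 hmem
      rw [← hv]
      exact overwrite_lt v q
    obtain ⟨s', hE, hI'⟩ := exec_rowLoop (a := a) hW hw hrBL (s := s) (by
      obtain ⟨⟩ := hI
      constructor <;> try assumption
      · rfl
      · exact ⟨fun i' hi' => absurd hi' (Nat.not_lt_zero i'),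
          fun j hj => absurd hj (Nat.not_lt_zero j)⟩)
    rw [hE.run_eq hd', PMF.pure_map]
    congr 1
    simp only [output, hI'.h3, if_true]
    congr 1
    ext i j
    exact hI'.hout.1 i i.2 j j.2
  have hrun : run W T (some ([program c], inputStore A k ε)) =
      μ.bind fun s => run W d (some ([rowLoop], s)) := by
    rw [hd, program, run_succ_of_step_eq (c' := some ([prepare c, .seq drawLoop rowLoop],
      inputStore A k ε)) rfl, hE₁, run_succ_of_step_eq (c' := some ([drawLoop, rowLoop], s₁)) rfl, hμ]
  rw [Computes, hrun, PMF.map_bind, PMF.bind_congr_support μ hrow]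
  have h1 : (μ.bind fun s => PMF.pure (some (mat (s.imem 0)))) =
      (μ.map fun s => s.imem 0).map fun w => some (mat w) := by
    rw [PMF.map_comp]
    rfl
  rw [h1, hmap, PMF.map_comp, KMeans.features_eq_map_signCols, ← map_signsOfWords hrBL,
    PMF.map_comp, PMF.map_comp]
  congr 1
  ext1 v
  simp only [Function.comp_apply, Option.some.injEq]
  ext i j
  exact entry_overwrite A hrBL v i j

end Mailman

end RealRAM

/-! ### The constants, and both statements together -/

theorem mainTheorem2 :
    ∃ c₀ : ℕ, ∀ c : ℕ, c₀ ≤ c → ∃ (P : RealRAM.Program) (K : ℕ),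
      ∀ (m n k : ℕ) (ε : ℝ) (A : Matrix (Fin m) (Fin n) ℝ),
        1 ≤ k → k ≤ m → 0 < ε → ε < 1 / 3 →
        (2 ≤ n →
          RealRAM.Computes P
            (K * (m * n * ⌈(k : ℝ) / ε ^ 2 / Real.log n⌉₊))
            (K * (m * n * ⌈(k : ℝ) / ε ^ 2 / Real.log n⌉₊))
            A k ε ⌈(c : ℝ) * k / ε ^ 2⌉₊ (KMeans.features A ⌈(c : ℝ) * k / ε ^ 2⌉₊)) ∧
        ∀ (γ δ : ℝ)
          (alg : Matrix (Fin m) (Fin ⌈(c : ℝ) * k / ε ^ 2⌉₊) ℝ → PMF (Matrix (Fin m) (Fin k) ℝ)),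
          KMeans.IsApproximation γ δ alg →
          ENNReal.ofReal (0.96 - δ) ≤
            ((KMeans.features A ⌈(c : ℝ) * k / ε ^ 2⌉₊).bind alg).toOuterMeasure
              {X | KMeans.IsIndicator X ∧
                KMeans.cost A X ≤ (1 + (1 + ε) * γ) * KMeans.optCost A k} := by
  refine ⟨100000000, fun c hc => ⟨RealRAM.Mailman.program c, 1000 * (c + 1),
    fun m n k ε A hk hkm hε hε' => ⟨fun hn => ?_, fun γ δ alg halg =>
      KMeans.ofReal_le_features_bind hc hk hkm hε hε' (Nat.le_ceil _) A alg halg⟩⟩⟩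
  set q := ⌈(k : ℝ) / ε ^ 2 / Real.log n⌉₊ with hq
  set r := ⌈(c : ℝ) * k / ε ^ 2⌉₊ with hr
  set L := Nat.log 2 n with hL
  have hL0 : 0 < L := Nat.log_pos (by norm_num) hn
  have hn1 : (1 : ℝ) < n := by exact_mod_cast hn
  have hlog : 0 < Real.log n := Real.log_pos hn1
  have hk0 : (0 : ℝ) < k := by exact_mod_cast hk
  -- The ceiling is at least 1, so the bound dominates m, n and mn, which absorbs all lower-order
  -- costs.
  have hq1 : 1 ≤ q := Nat.one_le_iff_ne_zero.2 (Nat.ceil_pos.2 (by positivity)).ne'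
  -- From n ≤ 2^(L+1), log 2 ≤ 1 and L + 1 ≤ 2L. This turns the natural logarithm of the time bound
  -- into the word length, so there are O(q) blocks.
  have hlogL : Real.log n ≤ 2 * L := by
    have h1 : (n : ℝ) ≤ 2 ^ (L + 1) := by
      exact_mod_cast (Nat.lt_pow_succ_log_self (by norm_num) n).le
    have h2 := Real.log_le_log (by linarith) h1
    rw [Real.log_pow] at h2
    have h3 : (1 : ℝ) ≤ L := by exact_mod_cast hL0
    have h4 : Real.log 2 ≤ 1 := by linarith [Real.log_two_lt_d9]
    push_cast at h2
    nlinarith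
  have hrq : r ≤ 2 * c * q * L := by
    rw [hr, Nat.ceil_le]
    have h1 : (k : ℝ) / ε ^ 2 ≤ q * Real.log n := (div_le_iff₀ hlog).1 (Nat.le_ceil _)
    have h2 : (c : ℝ) * k / ε ^ 2 = c * (k / ε ^ 2) := by ring
    push_cast
    rw [h2]
    calc (c : ℝ) * (k / ε ^ 2) ≤ c * (q * (2 * L)) := by gcongr; exact h1.trans (by gcongr)
      _ = 2 * c * q * L := by ring
  have hB : r / L + 1 ≤ (2 * c + 1) * q := by
    have h1 : r / L ≤ 2 * c * q := Nat.div_le_of_le_mul (by rw [mul_comm]; exact hrq)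
    rw [Nat.add_mul, one_mul]
    omega
  have hpow : 2 ^ L ≤ n := Nat.pow_log_le_self 2 (by omega)
  have hLn : L ≤ n := (Nat.lt_two_pow_self (n := L)).le.trans hpow
  have hm : 1 ≤ m := hk.trans hkm
  set B := r / L + 1 with hBdef
  set Z := m * n * q with hZ
  have hnZ : n ≤ Z := by
    rw [hZ]
    calc n = 1 * n * 1 := by ring
      _ ≤ _ := by gcongr
  have hmnZ : m * n ≤ Z := Nat.le_mul_of_pos_right _ hq1
  have hmZ : m ≤ Z := (Nat.le_mul_of_pos_right m (by omega)).trans hmnZ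
  have hmBn : m * (B * n) ≤ (2 * c + 1) * Z := by
    calc m * (B * n) ≤ m * ((2 * c + 1) * q * n) := by gcongr
      _ = (2 * c + 1) * Z := by rw [hZ]; ring
  have hBn : B * n ≤ (2 * c + 1) * Z := (Nat.le_mul_of_pos_left _ hm).trans hmBn
  have hBB : B ≤ (2 * c + 1) * Z := (Nat.le_mul_of_pos_right B (by omega)).trans hBn
  have hBL : B * L ≤ (2 * c + 1) * Z := (Nat.mul_le_mul_left B hLn).trans hBn
  have hmr : m * r ≤ 2 * (c * Z) := by
    calc m * r ≤ m * (2 * c * q * n) := by gcongr; exact hrq.trans (by gcongr)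
      _ = 2 * (c * Z) := by rw [hZ]; ring
  have hrZ : r ≤ 2 * (c * Z) := (Nat.le_mul_of_pos_left _ hm).trans hmr
  have hck : c * k ≤ c * Z := Nat.mul_le_mul_left c (hkm.trans hmZ)
  have hcZ : c ≤ c * Z := Nat.le_mul_of_pos_right c (by omega)
  have hexp : (2 * c + 1) * Z = 2 * (c * Z) + Z := by ring
  have hexp2 : 1000 * (c + 1) * Z = 1000 * (c * Z) + 1000 * Z := by ring
  have hrows : m * (B * (100 * n) + 13) = 100 * (m * (B * n)) + 13 * m := by ring
  rw [hexp] at hmBn hBn hBB hBL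
  rw [hexp2]
  refine RealRAM.Mailman.computes_features A hr hL hL0 hBdef ?_ (by omega) (by omega) (by omega) ?_
  · constructor <;> omega
  · rw [hrows]
    omega
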